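/- Fix environment parameters $\eta,\mu>0$, path-loss exponents $0<\alpha_L<\alpha_N$, transmit powers $P_{UA},P_M>0$ and a density $\lambda_M>0$. For a UAV access point (UAV-AP) at distance $d$ and height $h$ from a typical user at the origin, let the line-of-sight (LoS) probability be $$W_L(d,h)=\frac{1}{1+\eta\exp\left(-\mu\left(\frac{180}{\pi}\sin^{-1}\frac hd-\eta\right)\right)},$$ and write $W_L(\theta)=W_L(d,d\cos\theta)$, which does not depend on $d$. (a) Let the terrestrial base stations (TBSs) form a homogeneous Poisson point process of intensity $\lambda_M$ on $\mathbb R^2$, and let the UAV-APs form an independent homogeneous Poisson point process of intensity $\lambda_{UA}\ge 0$ on $\mathbb R^2\times\mathbb R^+$, each UAV-AP being independently LoS with probability $W_L$ and non-line-of-sight (NLoS) otherwise. Let $d_{MA},d_{UAL},d_{UAN}$ be the distances from the user to the closest TBS, LoS UAV-AP and NLoS UAV-AP (with value $\infty$ and received power $0$ if there is none), and let $\bar A_{UAL}(\lambda_{UA})$ be the probability that the user is associated with an LoS UAV-AP, i.e. that the average received power $P_{UA}d_{UAL}^{-\alpha_L}$ is larger than both $P_{UA}d_{UAN}^{-\alpha_N}$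 and $P_Md_{MA}^{-\alpha_N}$. Then $\bar A_{UAL}(\lambda_{UA})\to0$ as $\lambda_{UA}\to\infty$, and there is a finite $\lambda^*>0$ with $\bar A_{UAL}(\lambda_{UA})\le\bar A_{UAL}(\lambda^*)$ for all $\lambda_{UA}\ge0$. (b) The same two assertions hold for the closed-form expression $\bar A_{UAL}(\lambda_{UA})=\int_0^\infty \left(A'(y)+A''(y)\right)f_{L}(y)\,dy$, where $W'_L=\int_0^{\pi/2}W_L(\theta)\sin\theta\,d\theta$, $W'_N=\int_0^{\pi/2}(1-W_L(\theta))\sin\theta\,d\theta$, $f_M(x)=2\pi\lambda_Mx\,e^{-\pi\lambda_Mx^2}$, $f_{k}(x)=2\pi\lambda_{UA}x^2W'_k\,e^{-\frac23\pi\lambda_{UA}W'_kx^3}$ for $k\in\{L,N\}$, and, with $c=P_M/P_{UA}$, $$A'(y)=\int_{c^{1/\alpha_N}y^{\alpha_L/\alpha_N}}^\infty\left[e^{-\frac23\pi\lambda_{UA}W'_N y^{3\alpha_L/\alpha_N}}-e^{-\frac23\pi\lambda_{UA}W'_N c^{-3/\alpha_N}x^3}\right]e^{-\pi\lambda_M c^{2/\alpha_N}y^{2\alpha_L/\alpha_N}}f_M(x)\,dx,$$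 $$A''(y)=\int_{y^{\alpha_L/\alpha_N}}^\infty\left[e^{-\pi\lambda_M c^{2/\alpha_N}y^{2\alpha_L/\alpha_N}}-e^{-\pi\lambda_M c^{2/\alpha_N}x^2}\right]e^{-\frac23\pi\lambda_{UA}W'_N y^{3\alpha_L/\alpha_N}}f_N(x)\,dx.$$ -/

import Mathlib

open MeasureTheory ProbabilityTheory Filter Topology
open scoped ENNReal NNReal unitInterval

universe u

noncomputable section

/-- The parameters of the network, apart from the UAV-AP density: the environment parameters `η`, `μ`,
the path-loss exponents of LoS and NLoS links, the transmit powers of UAV-APs and of terrestrial base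
stations (TBSs), and the density of TBSs. -/
structure NetParams where
  η : ℝ
  μ : ℝ
  αL : ℝ
  αN : ℝ
  PUA : ℝ
  PM : ℝ
  lamM : ℝ

/-- Probability that a UAV-AP at distance `d` and height `h` is in line of sight. -/
def losProb (p : NetParams) (d h : ℝ) : ℝ :=
  1 / (1 + p.η * Real.exp (-p.μ * (180 / Real.pi * Real.arcsin (h / d) - p.η)))

/-! ### The stochastic-geometry model -/

/-- The (possibly infinite) number of points of the random set `Φ` in `B`. -/
def pointCount {Ω E : Type*} (Φ : Ω → Set E) (B : Set E) (ω : Ω) : ℕ∞ := (Φ ω ∩ B).encard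

/-- The random set `Φ` is a Poisson point process with intensity measure `Λ`. -/
structure IsPoissonPointProcess {Ω E : Type*} [MeasurableSpace Ω] [MeasurableSpace E]
    (Pr : Measure Ω) (Φ : Ω → Set E) (Λ : Measure E) : Prop where
  measurable_count : ∀ B : Set E, MeasurableSet B → Measurable (pointCount Φ B)
  poisson_count : ∀ B : Set E, MeasurableSet B → Λ B ≠ ∞ → ∀ k : ℕ,
    Pr {ω | pointCount Φ B ω = (k : ℕ∞)} = poissonMeasure (Λ B).toNNReal {k}
  indep_count : ∀ (n : ℕ) (B : Fin n → Set E), (∀ i, MeasurableSet (B i)) →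
    (∀ i j, i ≠ j → Disjoint (B i) (B j)) → iIndepFun (fun i => pointCount Φ (B i)) Pr

/-- The σ-algebra generated by the point counts of a random set. -/
@[reducible] def pointSigma {Ω E : Type*} [MeasurableSpace E] (Φ : Ω → Set E) : MeasurableSpace Ω :=
  ⨆ B : {B : Set E // MeasurableSet B}, MeasurableSpace.comap (pointCount Φ B.1) ⊤

/-- The ground plane, which contains the TBSs and, at the origin, the typical user. -/
abbrev Ground := EuclideanSpace ℝ (Fin 2)

/-- Three-dimensional space; the third coordinate is the height above the ground. -/
abbrev Space := EuclideanSpace ℝ (Fin 3)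

/-- The open upper half-space `ℝ² × ℝ⁺`. -/
def upperSpace : Set Space := {x | 0 < x 2}

/-- A network with UAV-AP density `lam`. TBSs form a homogeneous Poisson process on the plane.
UAV-APs form a homogeneous Poisson process on the upper half-space whose points carry independent
uniform marks in `[0,1]`, used to decide their visibility state; it is independent of the TBSs. -/
structure UAVNetwork (p : NetParams) (lam : ℝ≥0) where
  Ω : Type u
  mΩ : MeasurableSpace Ω
  Pr : Measure Ω
  isProb : IsProbabilityMeasure Pr
  tbs : Ω → Set Ground
  uav : Ω → Set (Space × I)
  tbs_poisson : IsPoissonPointProcess Pr tbs (ENNReal.ofReal p.lamM • volume)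
  uav_poisson : IsPoissonPointProcess Pr uav
    ((lam : ℝ≥0∞) • ((volume.restrict upperSpace).prod volume))
  indep : Indep (pointSigma tbs) (pointSigma uav) Pr

namespace UAVNetwork

variable {p : NetParams} {lam : ℝ≥0} (N : UAVNetwork p lam)

/-- Positions of the LoS UAV-APs: a UAV-AP at `x` is in LoS when its mark is below `W_L` at `x`. -/
def losUAV (ω : N.Ω) : Set Space := {x | ∃ u : I, (x, u) ∈ N.uav ω ∧ (u : ℝ) < losProb p ‖x‖ (x 2)}

/-- Positions of the NLoS UAV-APs. -/
def nlosUAV (ω : N.Ω) : Set Space := {x | ∃ u : I, (x, u) ∈ N.uav ω ∧ losProb p ‖x‖ (x 2) ≤ (u : ℝ)}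

/-- Distance from the typical user to the closest TBS (`∞` if there is none). -/
def dMA (ω : N.Ω) : ℝ≥0∞ := Metric.infEDist 0 (N.tbs ω)

/-- Distance from the typical user to the closest LoS UAV-AP (`∞` if there is none). -/
def dUAL (ω : N.Ω) : ℝ≥0∞ := Metric.infEDist 0 (N.losUAV ω)

/-- Distance from the typical user to the closest NLoS UAV-AP (`∞` if there is none). -/
def dUAN (ω : N.Ω) : ℝ≥0∞ := Metric.infEDist 0 (N.nlosUAV ω)

/-- Average power received from the closest TBS, up to the constant common to all links. -/
def rMA (ω : N.Ω) : ℝ≥0∞ := ENNReal.ofReal p.PM * N.dMA ω ^ (-p.αN)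

/-- Average power received from the closest LoS UAV-AP, up to the common constant. -/
def rUAL (ω : N.Ω) : ℝ≥0∞ := ENNReal.ofReal p.PUA * N.dUAL ω ^ (-p.αL)

/-- Average power received from the closest NLoS UAV-AP, up to the common constant. -/
def rUAN (ω : N.Ω) : ℝ≥0∞ := ENNReal.ofReal p.PUA * N.dUAN ω ^ (-p.αN)

/-- Probability that the typical user is associated with an LoS UAV-AP, i.e. that the closest LoS
UAV-AP is received with the strictly largest average power. -/
def losAssocProb : ℝ :=
  letI := N.mΩ
  N.Pr.real {ω | N.rUAN ω < N.rUAL ω ∧ N.rMA ω < N.rUAL ω}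

end UAVNetwork

/-! ### The closed-form expression -/

/-- `W_L(θ)`, the LoS probability in terms of the polar angle. -/
def WL (p : NetParams) (θ : ℝ) : ℝ := losProb p 1 (Real.cos θ)

/-- `W'_L`. -/
def WL' (p : NetParams) : ℝ := ∫ θ in (0 : ℝ)..(Real.pi / 2), WL p θ * Real.sin θ

/-- `W'_N`. -/
def WN' (p : NetParams) : ℝ := ∫ θ in (0 : ℝ)..(Real.pi / 2), (1 - WL p θ) * Real.sin θ

/-- Density of the distance to the closest TBS. -/
def fMA (p : NetParams) (x : ℝ) : ℝ :=
  2 * Real.pi * p.lamM * x * Real.exp (-(Real.pi * p.lamM * x ^ 2))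

/-- Density of the distance to the closest LoS UAV-AP. -/
def fUAL (p : NetParams) (lam x : ℝ) : ℝ :=
  2 * Real.pi * lam * x ^ 2 * WL' p * Real.exp (-(2 / 3 * Real.pi * lam * WL' p * x ^ 3))

/-- Density of the distance to the closest NLoS UAV-AP. -/
def fUAN (p : NetParams) (lam x : ℝ) : ℝ :=
  2 * Real.pi * lam * x ^ 2 * WN' p * Real.exp (-(2 / 3 * Real.pi * lam * WN' p * x ^ 3))

/-- `A'_UAL(d)`. -/
def AUAL' (p : NetParams) (lam d : ℝ) : ℝ :=
  ∫ x in Set.Ioi ((p.PM / p.PUA) ^ (1 / p.αN) * d ^ (p.αL / p.αN)),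
    (Real.exp (-(2 / 3 * Real.pi * lam * WN' p * d ^ (3 * p.αL / p.αN)))
      - Real.exp (-(2 / 3 * Real.pi * lam * WN' p *
          ((p.PUA / p.PM) ^ (3 / p.αN) * x ^ (3 * p.αN / p.αN)))))
    * Real.exp (-(Real.pi * p.lamM * ((p.PM / p.PUA) ^ (2 / p.αN) * d ^ (2 * p.αL / p.αN))))
    * fMA p x

/-- `A''_UAL(d)`. -/
def AUAL'' (p : NetParams) (lam d : ℝ) : ℝ :=
  ∫ x in Set.Ioi (d ^ (p.αL / p.αN)),
    (Real.exp (-(Real.pi * p.lamM * ((p.PM / p.PUA) ^ (2 / p.αN) * d ^ (2 * p.αL / p.αN))))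
      - Real.exp (-(Real.pi * p.lamM * ((p.PM / p.PUA) ^ (2 / p.αN) * x ^ (2 * p.αN / p.αN)))))
    * Real.exp (-(2 / 3 * Real.pi * lam * WN' p * d ^ (3 * p.αL / p.αN)))
    * fUAN p lam x

/-- `A_UAL(d) = A'_UAL(d) + A''_UAL(d)`. -/
def AUAL (p : NetParams) (lam d : ℝ) : ℝ := AUAL' p lam d + AUAL'' p lam d

/-- The deconditioned expression `∫₀^∞ A_UAL(x) f_{d_UAL}(x) dx`. -/
def AbarUAL (p : NetParams) (lam : ℝ) : ℝ :=
  ∫ x in Set.Ioi (0 : ℝ), AUAL p lam x * fUAL p lam x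

end

/-! Both functions of the UAV density λ are continuous and nonnegative on (0, ∞) and vanish at both
ends, so each attains its maximum on (0, ∞), and the value 0 at λ = 0 does not compete.

For the network, everything reduces to void probabilities. The marks turn LoS and NLoS points into
disjoint conical regions of a single Poisson process, whose intersections with balls have volume
proportional to r³. Hence the three nearest distances are independent with Weibull tails, and the
LoS distance has the law of (t/(λ c_L))^(1/3) with t standard exponential. Conditioning on it
(`losAssocProb_eq`) writes the association probability as an integral of a function bounded by 1
against a law free of λ, so limits and continuity follow by dominated convergence. With β = αL/αN <
1 the NLoS exponent is a constant multiple of λ (t/(λ c_L))^β, of order λ^(1-β), which diverges as λ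
→ ∞: the NLoS links win. As λ → 0 the LoS distance diverges and the TBSs win. The constants c_L and
c_N need only be positive and finite.

The closed form is estimated directly; no identity with the network probability is used. Both
brackets are at most their first terms, so the integrand is at most a constant times λ y² times an
NLoS factor and a TBS factor (`AbarUAL_le`). Keeping only the TBS factor gives O(λ) near 0; keeping
only the NLoS factor gives a Gamma integral of order λ^(1-αN/αL) at infinity. -/

noncomputable section

/-! ### Maxima on the half-line and Weibull laws on [0, ∞]. -/

/-- A function on `(0, ∞)` that is continuous, nonnegative and vanishes at both ends attains its
maximum. -/
theorem exists_isMaxOn_Ioi_of_tendsto_zero {f : ℝ → ℝ} (hc : ContinuousOn f (Set.Ioi 0))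
    (hnn : ∀ x, 0 < x → 0 ≤ f x) (h0 : Tendsto f (𝓝[>] 0) (𝓝 0)) (hinf : Tendsto f atTop (𝓝 0)) :
    ∃ x₀, 0 < x₀ ∧ ∀ x, 0 < x → f x ≤ f x₀ := by
  by_cases h : ∃ z, 0 < z ∧ 0 < f z
  · obtain ⟨z, hz, hfz⟩ := h
    obtain ⟨b, hb⟩ := eventually_atTop.1 (hinf.eventually (gt_mem_nhds hfz))
    obtain ⟨a, ha, hab⟩ := mem_nhdsGT_iff_exists_Ioo_subset.1 (h0.eventually (gt_mem_nhds hfz))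
    have ha' : 0 < a := ha
    -- Outside this compact interval `f` stays below `f z`. Halving `a` keeps the left endpoint
    -- strictly inside the neighbourhood of 0, and `z` is adjoined so that the maximum dominates `f
    -- z`.
    have hsub : ∀ x ∈ Set.Icc (min (a / 2) z) (max b z), 0 < x := fun x hx =>
      lt_of_lt_of_le (lt_min (by positivity) hz) hx.1
    have hzm : z ∈ Set.Icc (min (a / 2) z) (max b z) := ⟨min_le_right _ _, le_max_right _ _⟩
    obtain ⟨m, hm, hmax⟩ := isCompact_Icc.exists_isMaxOn ⟨z, hzm⟩ (hc.mono hsub)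
    refine ⟨m, hsub m hm, fun x hx => ?_⟩
    by_cases hxI : x ∈ Set.Icc (min (a / 2) z) (max b z)
    · exact hmax hxI
    · refine le_trans (le_of_lt ?_) (hmax hzm)
      rw [Set.mem_Icc, not_and_or, not_le, not_le] at hxI
      rcases hxI with hx1 | hx1
      · exact hab ⟨hx, by linarith [hx1.trans_le (min_le_left (a / 2) z)]⟩
      · exact hb x ((le_max_left b z).trans hx1.le)
  · push Not at h
    exact ⟨1, one_pos, fun x hx => (h x hx).trans (hnn 1 one_pos)⟩

/-- The exponential law of rate one charges `[t, ∞)` with mass `exp (-t)`. -/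
theorem expMeasure_one_Ici {t : ℝ} (ht : 0 ≤ t) :
    expMeasure 1 (Set.Ici t) = ENNReal.ofReal (Real.exp (-t)) := by
  have := isProbabilityMeasure_expMeasure one_pos
  have hna : expMeasure 1 {t} = 0 := by
    have : expMeasure 1 ≪ volume := withDensity_absolutelyContinuous _ _
    exact this (by simp)
  have h1 : expMeasure 1 (Set.Ioi t) = ENNReal.ofReal (Real.exp (-t)) := by
    have h := cdf_expMeasure_eq one_pos t
    rw [if_pos ht, cdf_eq_real] at h
    have h2 : (expMeasure 1).real (Set.Iic t)ᶜ = Real.exp (-t) := by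
      rw [probReal_compl_eq_one_sub measurableSet_Iic, h]; simp
    rw [← Set.compl_Iic, ← h2, ofReal_measureReal]
  rw [← Set.Ioi_insert, Set.insert_eq]
  refine le_antisymm ((measure_union_le _ _).trans (by rw [hna, h1, zero_add])) ?_
  rw [← h1]
  exact measure_mono Set.subset_union_right

theorem expMeasure_one_ae_pos : ∀ᵐ t ∂(expMeasure 1), 0 < t := by
  have := isProbabilityMeasure_expMeasure one_pos
  have h := cdf_expMeasure_eq one_pos 0
  rw [if_pos le_rfl, cdf_eq_real] at h
  have h' : expMeasure 1 (Set.Iic 0) = 0 := by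
    rw [← ofReal_measureReal, h]; simp
  rw [ae_iff]
  simpa [Set.Iic] using h'

/-- A law on `[0, ∞]` with Weibull tail is a power transform of the exponential law. -/
theorem eq_map_expMeasure_of_weibull_tail {ν : Measure ℝ≥0∞} [IsProbabilityMeasure ν] {a k : ℝ}
    (ha : 0 < a) (hk : 0 < k)
    (h : ∀ r : ℝ, 0 ≤ r → ν (Set.Ici (ENNReal.ofReal r)) = ENNReal.ofReal (Real.exp (-(a * r ^ k)))) :
    ν = (expMeasure 1).map (fun t => ENNReal.ofReal ((t / a) ^ (1 / k))) := by
  have := isProbabilityMeasure_expMeasure one_pos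
  have hmeas : Measurable (fun t : ℝ => ENNReal.ofReal ((t / a) ^ (1 / k))) := by fun_prop
  have : IsProbabilityMeasure ((expMeasure 1).map
    (fun t => ENNReal.ofReal ((t / a) ^ (1 / k)))) := Measure.isProbabilityMeasure_map hmeas.aemeasurable
  have hfin : ∀ r : ℝ, 0 ≤ r → ν (Set.Ici (ENNReal.ofReal r)) =
      (expMeasure 1).map (fun t => ENNReal.ofReal ((t / a) ^ (1 / k)))
        (Set.Ici (ENNReal.ofReal r)) := by
    intro r hr
    have hrk : 0 ≤ a * r ^ k := mul_nonneg ha.le (Real.rpow_nonneg hr k)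
    rw [h r hr, Measure.map_apply hmeas measurableSet_Ici, ← expMeasure_one_Ici hrk]
    refine measure_congr ?_
    -- The equivalence is claimed only for positive `t`: on negative bases the real power is not the
    -- inverse of `r ↦ a * r ^ k`.
    filter_upwards [expMeasure_one_ae_pos] with t ht
    apply propext
    change a * r ^ k ≤ t ↔ ENNReal.ofReal r ≤ ENNReal.ofReal ((t / a) ^ (1 / k))
    rw [ENNReal.ofReal_le_ofReal_iff (by positivity), one_div,
      Real.le_rpow_inv_iff_of_pos hr (by positivity) hk, le_div_iff₀ ha, mul_comm]
  refine ext_of_generate_finite _ ((BorelSpace.measurable_eq).trans (borel_eq_generateFrom_Ici ℝ≥0∞))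
    isPiSystem_Ici ?_ (by rw [measure_univ, measure_univ])
  rintro _ ⟨r, rfl⟩
  -- The tail hypothesis covers finite thresholds only; the mass at ∞ is recovered as a decreasing
  -- limit along the integers.
  by_cases hr : r = ∞
  · subst hr
    have hz : ∀ (ρ : Measure ℝ≥0∞) [IsProbabilityMeasure ρ],
        Tendsto (fun n : ℕ => ρ (Set.Ici (ENNReal.ofReal n))) atTop (𝓝 (ρ (Set.Ici ∞))) := by
      intro ρ _
      have : Set.Ici (∞ : ℝ≥0∞) = ⋂ n : ℕ, Set.Ici (ENNReal.ofReal n) := by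
        ext x
        simp only [Set.mem_Ici, top_le_iff, Set.mem_iInter, ENNReal.ofReal_natCast]
        refine ⟨fun hx n => hx ▸ le_top, fun hx => ENNReal.eq_top_of_forall_nnreal_le fun q => ?_⟩
        obtain ⟨n, hn⟩ := exists_nat_ge q
        exact le_trans (by exact_mod_cast hn) (hx n)
      rw [this]
      refine tendsto_measure_iInter_atTop (fun n => measurableSet_Ici.nullMeasurableSet) ?_
        ⟨0, measure_ne_top _ _⟩
      intro m n hmn
      exact Set.Ici_subset_Ici.2 (ENNReal.ofReal_le_ofReal (by exact_mod_cast hmn))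
    refine tendsto_nhds_unique (hz ν) ?_
    refine (hz _).congr fun n => (hfin n (Nat.cast_nonneg n)).symm
  · rw [← ENNReal.ofReal_toReal hr]
    exact hfin _ ENNReal.toReal_nonneg

/-- A Weibull tail has the same values on open rays as on closed ones. -/
theorem measure_Ioi_of_weibull_tail {ν : Measure ℝ≥0∞} {a k : ℝ} (hk : 0 < k)
    (h : ∀ r : ℝ, 0 ≤ r → ν (Set.Ici (ENNReal.ofReal r)) = ENNReal.ofReal (Real.exp (-(a * r ^ k))))
    {r : ℝ} (hr : 0 ≤ r) :
    ν (Set.Ioi (ENNReal.ofReal r)) = ENNReal.ofReal (Real.exp (-(a * r ^ k))) := by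
  refine le_antisymm ((measure_mono Set.Ioi_subset_Ici_self).trans (h r hr).le) ?_
  have hcont : Continuous fun s : ℝ => ENNReal.ofReal (Real.exp (-(a * s ^ k))) := by
    have : Continuous fun s : ℝ => s ^ k := Real.continuous_rpow_const hk.le
    exact ENNReal.continuous_ofReal.comp (by fun_prop)
  -- The open ray contains every closed ray starting at `s > r`; let `s` decrease to `r` and use
  -- continuity of the tail.
  refine le_of_tendsto (hcont.continuousWithinAt (s := Set.Ioi r) (x := r)) ?_
  filter_upwards [self_mem_nhdsWithin] with s hs
  have hs' : r < s := hs
  rw [← h s (hr.trans hs'.le)]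
  exact measure_mono (Set.Ici_subset_Ioi.2
    ((ENNReal.ofReal_lt_ofReal_iff (hr.trans_lt hs')).2 hs'))

/-- Path loss is strictly decreasing on all of [0, ∞], including a link at distance ∞ with power 0,
so power comparisons become distance comparisons. -/
theorem ofReal_mul_rpow_neg_lt_iff {P α : ℝ} (hP : 0 < P) (hα : 0 < α) (x s : ℝ≥0∞) :
    ENNReal.ofReal P * x ^ (-α) < ENNReal.ofReal P * s ^ (-α) ↔ s < x := by
  rw [ENNReal.mul_lt_mul_iff_right (by simpa using hP) ENNReal.ofReal_ne_top, ENNReal.rpow_neg,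
    ENNReal.rpow_neg, ENNReal.inv_lt_inv, ENNReal.rpow_lt_rpow_iff hα]

/-! ### Void probabilities and the σ-algebra of counts. -/

namespace IsPoissonPointProcess

variable {Ω E : Type*} [MeasurableSpace Ω] [MeasurableSpace E] {Pr : Measure Ω} {Φ : Ω → Set E}
  {Λ : Measure E}

/-- The void probabilities of a Poisson point process. -/
theorem measure_pointCount_eq_zero (h : IsPoissonPointProcess Pr Φ Λ) {B : Set E}
    (hB : MeasurableSet B) (hΛ : Λ B ≠ ∞) :
    Pr {ω | pointCount Φ B ω = 0} = ENNReal.ofReal (Real.exp (-(Λ B).toReal)) := by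
  have := h.poisson_count B hB hΛ 0
  rw [poissonMeasure_singleton] at this
  simpa [ENNReal.coe_toNNReal_eq_toReal] using this

end IsPoissonPointProcess

theorem measurableSet_pointSigma {Ω E : Type*} [MeasurableSpace E] (Φ : Ω → Set E) {B : Set E}
    (hB : MeasurableSet B) : MeasurableSet[pointSigma Φ] {ω | pointCount Φ B ω = 0} :=
  le_iSup (fun B : {B : Set E // MeasurableSet B} => MeasurableSpace.comap (pointCount Φ B.1) ⊤)
    ⟨B, hB⟩ _ ⟨{0}, trivial, rfl⟩

theorem pointSigma_le {Ω E : Type*} [mΩ : MeasurableSpace Ω] [MeasurableSpace E] {Φ : Ω → Set E}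
    (h : ∀ B : Set E, MeasurableSet B → Measurable (pointCount Φ B)) : pointSigma Φ ≤ mΩ :=
  iSup_le fun B => (h B.1 B.2).comap_le

theorem pointCount_eq_zero_iff {Ω E : Type*} {Φ : Ω → Set E} {B : Set E} {ω : Ω} :
    pointCount Φ B ω = 0 ↔ ∀ x ∈ Φ ω, x ∉ B := by
  rw [pointCount, Set.encard_eq_zero, Set.eq_empty_iff_forall_notMem]
  exact ⟨fun h x hx hB => h x ⟨hx, hB⟩, fun h x hx => h x hx.1 hx.2⟩

/-! ### Volumes of the LoS and NLoS regions. -/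

/-- Marked points in line of sight at distance less than `r`. -/
def losRegion (p : NetParams) (r : ℝ≥0∞) : Set (Space × I) :=
  {q | ‖q.1‖ₑ < r ∧ (q.2 : ℝ) < losProb p ‖q.1‖ (q.1 2)}

/-- Marked points out of line of sight at distance less than `r`. -/
def nlosRegion (p : NetParams) (r : ℝ≥0∞) : Set (Space × I) :=
  {q | ‖q.1‖ₑ < r ∧ losProb p ‖q.1‖ (q.1 2) ≤ (q.2 : ℝ)}

/-- The intensity measure of the marked UAV-AP process at unit density. -/
def markedVolume : Measure (Space × I) := (volume.restrict upperSpace).prod volume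

@[fun_prop]
theorem measurable_losProb (p : NetParams) :
    Measurable fun q : Space × I => losProb p ‖q.1‖ (q.1 2) := by
  have h2 : Measurable fun q : Space × I => q.1 2 :=
    (EuclideanSpace.proj (𝕜 := ℝ) (2 : Fin 3)).continuous.measurable.comp measurable_fst
  have h1 : Measurable fun q : Space × I => ‖q.1‖ := by fun_prop
  have h3 := Real.continuous_arcsin.measurable.comp (h2.div h1)
  unfold losProb
  simp only [Function.comp_def, Pi.div_apply] at h3
  fun_prop

theorem measurableSet_losRegion (p : NetParams) (r : ℝ≥0∞) : MeasurableSet (losRegion p r) := by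
  have h : Measurable fun q : Space × I => (q.2 : ℝ) := measurable_subtype_coe.comp measurable_snd
  have h' : Measurable fun q : Space × I => ‖q.1‖ₑ := by fun_prop
  exact (measurableSet_lt h' measurable_const).inter
    (measurableSet_lt h (measurable_losProb p))

theorem measurableSet_nlosRegion (p : NetParams) (r : ℝ≥0∞) : MeasurableSet (nlosRegion p r) := by
  have h : Measurable fun q : Space × I => (q.2 : ℝ) := measurable_subtype_coe.comp measurable_snd
  have h' : Measurable fun q : Space × I => ‖q.1‖ₑ := by fun_prop
  exact (measurableSet_lt h' measurable_const).inter
    (measurableSet_le (measurable_losProb p) h)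

theorem measurableSet_upperSpace : MeasurableSet upperSpace :=
  measurableSet_lt measurable_const
    (EuclideanSpace.proj (𝕜 := ℝ) (2 : Fin 3)).continuous.measurable

theorem disjoint_losRegion_nlosRegion (p : NetParams) (r s : ℝ≥0∞) :
    Disjoint (losRegion p r) (nlosRegion p s) :=
  Set.disjoint_left.2 fun _ h1 h2 => absurd h1.2 (not_lt.2 h2.2)

/-- The LoS probability sees only the ratio of height to distance; this is what makes the two
regions cones. -/
theorem losProb_scale (p : NetParams) {r : ℝ} (hr : 0 < r) (x : Space) :
    losProb p ‖r • x‖ ((r • x) 2) = losProb p ‖x‖ (x 2) := by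
  simp only [losProb, norm_smul, Real.norm_of_nonneg hr.le, PiLp.smul_apply, smul_eq_mul]
  rw [mul_div_mul_left _ _ hr.ne']

/-- A cone meets the balls around the origin in volume proportional to the cube of the radius. -/
theorem volume_cone_inter_ball {K : Set (Space × I)} (hK : MeasurableSet K)
    (hcone : ∀ r : ℝ, 0 < r → ∀ x u, (r • x, u) ∈ K ↔ (x, u) ∈ K) {r : ℝ} (hr : 0 ≤ r) :
    (volume.prod volume) (K ∩ {q | ‖q.1‖ₑ < ENNReal.ofReal r}) =
      ENNReal.ofReal (r ^ 3) * (volume.prod volume) (K ∩ {q | ‖q.1‖ₑ < 1}) := by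
  rcases hr.eq_or_lt with rfl | hr
  · simp
  have hmeas : Measurable fun x : Space => r • x := measurable_const_smul r
  have hmap : (volume.prod volume).map (Prod.map (fun x : Space => r • x) (id : I → I)) =
      (ENNReal.ofReal (r ^ 3))⁻¹ • (volume.prod volume) := by
    rw [← Measure.map_prod_map _ _ hmeas measurable_id, Measure.map_addHaar_smul _ hr.ne',
      Measure.map_id, Measure.prod_smul_left, finrank_euclideanSpace, Fintype.card_fin,
      abs_of_pos (by positivity), ENNReal.ofReal_inv_of_pos (by positivity)]
  have hball : MeasurableSet {q : Space × I | ‖q.1‖ₑ < ENNReal.ofReal r} :=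
    measurableSet_lt (by fun_prop) measurable_const
  have hpre : Prod.map (fun x : Space => r • x) (id : I → I) ⁻¹'
      (K ∩ {q | ‖q.1‖ₑ < ENNReal.ofReal r}) = K ∩ {q | ‖q.1‖ₑ < 1} := by
    ext ⟨x, u⟩
    simp only [Set.mem_preimage, Prod.map_apply, id, Set.mem_inter_iff, Set.mem_ofPred_eq,
      hcone r hr, enorm_smul, Real.enorm_of_nonneg hr.le]
    refine and_congr_right fun _ => ?_
    have h0 : ENNReal.ofReal r ≠ 0 := by simpa using hr
    -- The bare radius becomes `r * 1`, so that the common factor cancels.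
    conv_lhs => rw [← mul_one (ENNReal.ofReal r), mul_assoc, one_mul]
    rw [ENNReal.mul_lt_mul_iff_right h0 ENNReal.ofReal_ne_top]
  have h := congrArg (fun m => m (K ∩ {q | ‖q.1‖ₑ < ENNReal.ofReal r})) hmap
  simp only [Measure.smul_apply, smul_eq_mul] at h
  rw [Measure.map_apply (hmeas.prodMap measurable_id) (hK.inter hball), hpre] at h
  rw [h, ← mul_assoc, ENNReal.mul_inv_cancel (by simp only [ne_eq, ENNReal.ofReal_eq_zero, not_le]; positivity)
    ENNReal.ofReal_ne_top, one_mul]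

theorem markedVolume_apply {S : Set (Space × I)} (hS : MeasurableSet S) :
    markedVolume S = (volume.prod volume) (S ∩ upperSpace ×ˢ Set.univ) := by
  rw [markedVolume, ← Measure.restrict_univ (μ := (volume : Measure I)), Measure.prod_restrict,
    Measure.restrict_apply hS, Measure.restrict_univ]

theorem smul_mem_upperSpace_iff {r : ℝ} (hr : 0 < r) (x : Space) :
    r • x ∈ upperSpace ↔ x ∈ upperSpace := by
  simp [upperSpace, hr]

theorem markedVolume_losRegion (p : NetParams) {r : ℝ} (hr : 0 ≤ r) :
    markedVolume (losRegion p (ENNReal.ofReal r)) =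
      ENNReal.ofReal (r ^ 3) * markedVolume (losRegion p 1) := by
  -- A fixed cone, independent of `s`, cut by the ball of radius `s`.
  have h : ∀ s, losRegion p s ∩ upperSpace ×ˢ Set.univ =
      (losRegion p ∞ ∩ {q | ‖q.1‖ₑ < ∞} ∩ upperSpace ×ˢ Set.univ) ∩ {q | ‖q.1‖ₑ < s} := by
    intro s; ext q; simp [losRegion]; tauto
  have hm : MeasurableSet {q : Space × I | ‖q.1‖ₑ < ∞} :=
    measurableSet_lt (by fun_prop) measurable_const
  rw [markedVolume_apply (measurableSet_losRegion _ _),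
    markedVolume_apply (measurableSet_losRegion _ _), h, h,
    volume_cone_inter_ball (((measurableSet_losRegion p ∞).inter hm).inter
      (measurableSet_upperSpace.prod MeasurableSet.univ)) _ hr]
  intro r hr x u
  have hs := losProb_scale p hr x
  rw [PiLp.smul_apply, smul_eq_mul] at hs
  simp [losRegion, hs, smul_mem_upperSpace_iff hr]

theorem markedVolume_nlosRegion (p : NetParams) {r : ℝ} (hr : 0 ≤ r) :
    markedVolume (nlosRegion p (ENNReal.ofReal r)) =
      ENNReal.ofReal (r ^ 3) * markedVolume (nlosRegion p 1) := by
  have h : ∀ s, nlosRegion p s ∩ upperSpace ×ˢ Set.univ =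
      (nlosRegion p ∞ ∩ {q | ‖q.1‖ₑ < ∞} ∩ upperSpace ×ˢ Set.univ) ∩ {q | ‖q.1‖ₑ < s} := by
    intro s; ext q; simp [nlosRegion]; tauto
  have hm : MeasurableSet {q : Space × I | ‖q.1‖ₑ < ∞} :=
    measurableSet_lt (by fun_prop) measurable_const
  rw [markedVolume_apply (measurableSet_nlosRegion _ _),
    markedVolume_apply (measurableSet_nlosRegion _ _), h, h,
    volume_cone_inter_ball (((measurableSet_nlosRegion p ∞).inter hm).inter
      (measurableSet_upperSpace.prod MeasurableSet.univ)) _ hr]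
  intro r hr x u
  have hs := losProb_scale p hr x
  rw [PiLp.smul_apply, smul_eq_mul] at hs
  simp [nlosRegion, hs, smul_mem_upperSpace_iff hr]

theorem markedVolume_unitBall_ne_top {S : Set (Space × I)} (hS : ∀ q ∈ S, ‖q.1‖ₑ < 1) :
    markedVolume S ≠ ∞ := by
  have hsub : S ⊆ Metric.ball 0 1 ×ˢ Set.univ := fun q hq => by
    have := hS q hq
    rw [← ofReal_norm, ENNReal.ofReal_lt_one] at this
    simpa using this
  refine ne_top_of_le_ne_top ?_ (measure_mono hsub)
  rw [markedVolume, Measure.prod_prod, measure_univ, mul_one]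
  exact ((Measure.restrict_apply_le _ _).trans_lt measure_ball_lt_top).ne

/-- The line-of-sight probability is bounded away from zero and from one. -/
theorem exists_losProb_bounds {p : NetParams} (hη : 0 < p.η) (hμ : 0 < p.μ) :
    ∃ a b : ℝ, 0 < a ∧ a < 1 ∧ 0 < b ∧ b < 1 ∧ ∀ d h, a < losProb p d h ∧ losProb p d h < b := by
  have key : ∀ s : ℝ, 0 < p.η * Real.exp s := fun s => by positivity
  -- The angle in degrees lies in [-90, 90]; using 91 makes both bounds strict.
  refine ⟨1 / (1 + p.η * Real.exp (p.μ * (91 + p.η))),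
    1 / (1 + p.η * Real.exp (-p.μ * (91 - p.η))), by have := key (p.μ * (91 + p.η)); positivity,
    by rw [div_lt_one (by linarith [key (p.μ * (91 + p.η))])]; linarith [key (p.μ * (91 + p.η))],
    by have := key (-p.μ * (91 - p.η)); positivity,
    by rw [div_lt_one (by linarith [key (-p.μ * (91 - p.η))])];
       linarith [key (-p.μ * (91 - p.η))], fun d h => ?_⟩
  have hπ := Real.pi_pos
  have hle : 180 / Real.pi * Real.arcsin (h / d) ≤ 90 := by
    have := mul_le_mul_of_nonneg_left (Real.arcsin_le_pi_div_two (h / d))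
      (by positivity : 0 ≤ 180 / Real.pi)
    refine this.trans (le_of_eq ?_)
    field_simp; norm_num
  have hge : -90 ≤ 180 / Real.pi * Real.arcsin (h / d) := by
    have := mul_le_mul_of_nonneg_left (Real.neg_pi_div_two_le_arcsin (h / d))
      (by positivity : 0 ≤ 180 / Real.pi)
    refine le_trans (le_of_eq ?_) this
    field_simp; norm_num
  unfold losProb
  constructor
  · refine one_div_lt_one_div_of_lt (by linarith [key (-p.μ * (180 / Real.pi * Real.arcsin (h / d) - p.η))]) ?_
    exact (add_lt_add_iff_left 1).2 (mul_lt_mul_of_pos_left (Real.exp_lt_exp.2 (by nlinarith)) hη)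
  · refine one_div_lt_one_div_of_lt (by linarith [key (-p.μ * (91 - p.η))]) ?_
    exact (add_lt_add_iff_left 1).2 (mul_lt_mul_of_pos_left (Real.exp_lt_exp.2 (by nlinarith)) hη)

theorem markedVolume_pos {U : Set I} (hne : volume U ≠ 0) {S : Set (Space × I)}
    (hS : ∀ q : Space × I, ‖q.1‖ₑ < 1 → q.2 ∈ U → q ∈ S) : markedVolume S ≠ 0 := by
  have hsub : Metric.ball (0 : Space) 1 ×ˢ U ⊆ S := by
    rintro q ⟨h1, h2⟩
    refine hS q ?_ h2
    rw [← ofReal_norm, ENNReal.ofReal_lt_one]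
    simpa using h1
  have hopen : IsOpen (Metric.ball (0 : Space) 1 ∩ upperSpace) :=
    Metric.isOpen_ball.inter
      (isOpen_lt continuous_const (EuclideanSpace.proj (𝕜 := ℝ) (2 : Fin 3)).continuous)
  have hnonempty : (Metric.ball (0 : Space) 1 ∩ upperSpace).Nonempty := by
    refine ⟨EuclideanSpace.single 2 (1 / 2), ?_, ?_⟩
    · simp; norm_num
    · simp [upperSpace]
  intro h0
  have := measure_mono_null hsub h0
  rw [markedVolume, Measure.prod_prod, Measure.restrict_apply measurableSet_ball, mul_eq_zero] at this
  exact this.elim (hopen.measure_pos volume hnonempty).ne' hne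

/-- A mark below the uniform lower bound of the LoS probability is LoS at every position, so the
region contains a half-ball times an interval of marks. -/
theorem markedVolume_losRegion_one_pos {p : NetParams} (hη : 0 < p.η) (hμ : 0 < p.μ) :
    0 < (markedVolume (losRegion p 1)).toReal := by
  obtain ⟨a, b, ha0, ha1, -, -, h⟩ := exists_losProb_bounds hη hμ
  refine ENNReal.toReal_pos (markedVolume_pos (U := Set.Iio ⟨a, ha0.le, ha1.le⟩)
    (by simpa using ha0) fun q h1 h2 => ⟨h1, ?_⟩) (markedVolume_unitBall_ne_top fun q hq => hq.1)
  have h2' : (q.2 : ℝ) < a := h2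
  exact h2'.trans (h _ _).1

theorem markedVolume_nlosRegion_one_pos {p : NetParams} (hη : 0 < p.η) (hμ : 0 < p.μ) :
    0 < (markedVolume (nlosRegion p 1)).toReal := by
  obtain ⟨a, b, -, -, hb0, hb1, h⟩ := exists_losProb_bounds hη hμ
  refine ENNReal.toReal_pos (markedVolume_pos (U := Set.Ioi ⟨b, hb0.le, hb1.le⟩)
    (by simpa using hb1) fun q h1 h2 => ⟨h1, ?_⟩) (markedVolume_unitBall_ne_top fun q hq => hq.1)
  have h2' : b < (q.2 : ℝ) := h2
  exact ((h _ _).2.trans h2').le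

/-! ### Laws and independence of the three nearest distances. -/

/-- The σ-algebra is a variable here so that the criterion applies to `pointSigma` instead of the
ambient one. -/
theorem measurable_of_measurableSet_le {Ω : Type*} {m : MeasurableSpace Ω} {D : Ω → ℝ≥0∞}
    (h : ∀ r, MeasurableSet {ω | r ≤ D ω}) : Measurable D :=
  measurable_of_Ici h

/-- Independence of `[0, ∞]`-valued variables can be checked on the events `r ≤ X`, `s ≤ Y`. -/
theorem indepFun_of_indep_Ici {Ω : Type*} [MeasurableSpace Ω] {Pr : Measure Ω}
    [IsProbabilityMeasure Pr] {X Y : Ω → ℝ≥0∞} (hX : Measurable X) (hY : Measurable Y)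
    (h : ∀ r s, Pr (X ⁻¹' Set.Ici r ∩ Y ⁻¹' Set.Ici s) =
      Pr (X ⁻¹' Set.Ici r) * Pr (Y ⁻¹' Set.Ici s)) : IndepFun X Y Pr := by
  have hb : ∀ Z : Ω → ℝ≥0∞, MeasurableSpace.comap Z inferInstance =
      MeasurableSpace.generateFrom {s | ∃ t ∈ Set.range Set.Ici, Z ⁻¹' t = s} := by
    intro Z
    rw [show (inferInstance : MeasurableSpace ℝ≥0∞) = _ from
      (BorelSpace.measurable_eq).trans (borel_eq_generateFrom_Ici ℝ≥0∞),
      MeasurableSpace.comap_generateFrom]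
    rfl
  rw [IndepFun_iff_Indep]
  refine IndepSets.indep hX.comap_le hY.comap_le (isPiSystem_Ici.comap X) (isPiSystem_Ici.comap Y)
    (hb X) (hb Y) ((IndepSets_iff _ _ _).2 ?_)
  rintro _ _ ⟨_, ⟨r, rfl⟩, rfl⟩ ⟨_, ⟨s, rfl⟩, rfl⟩
  exact h r s

/-- The LoS distance as a function of a standard exponential variable `t`. -/
def losDist (p : NetParams) (lam t : ℝ) : ℝ :=
  (t / (lam * (markedVolume (losRegion p 1)).toReal)) ^ (1 / 3 : ℝ)

/-- The volume of the unit disc. -/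
def discVolume : ℝ := (volume (Metric.ball (0 : Ground) 1)).toReal

theorem discVolume_pos : 0 < discVolume :=
  ENNReal.toReal_pos (Metric.measure_ball_pos _ _ one_pos).ne' measure_ball_lt_top.ne

/-- Given an LoS UAV-AP at distance `y`, the probability that no other link is stronger. -/
def losDominance (p : NetParams) (lam y : ℝ) : ℝ :=
  Real.exp (-(lam * (markedVolume (nlosRegion p 1)).toReal * (y ^ (p.αL / p.αN)) ^ (3 : ℝ))) *
  Real.exp (-(p.lamM * discVolume *
    ((p.PM / p.PUA) ^ (1 / p.αN) * y ^ (p.αL / p.αN)) ^ (2 : ℝ)))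

namespace UAVNetwork

attribute [instance] UAVNetwork.mΩ UAVNetwork.isProb

variable {p : NetParams} {lam : ℝ≥0} (N : UAVNetwork p lam)

/-- The strict inequality in `losRegion` makes this exact: an infimum is at least `r` precisely when
no point is closer than `r`. -/
theorem le_dUAL_iff {r : ℝ≥0∞} {ω : N.Ω} :
    r ≤ N.dUAL ω ↔ pointCount N.uav (losRegion p r) ω = 0 := by
  rw [pointCount_eq_zero_iff, dUAL, Metric.le_infEDist]
  constructor
  · intro h q hq hqr
    have := h q.1 ⟨q.2, hq, hqr.2⟩
    rw [edist_zero_left] at this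
    exact not_lt.2 this hqr.1
  · rintro h x ⟨u, hu, hlt⟩
    rw [edist_zero_left]
    exact not_lt.1 fun hx => h (x, u) hu ⟨hx, hlt⟩

theorem le_dUAN_iff {r : ℝ≥0∞} {ω : N.Ω} :
    r ≤ N.dUAN ω ↔ pointCount N.uav (nlosRegion p r) ω = 0 := by
  rw [pointCount_eq_zero_iff, dUAN, Metric.le_infEDist]
  constructor
  · intro h q hq hqr
    have := h q.1 ⟨q.2, hq, hqr.2⟩
    rw [edist_zero_left] at this
    exact not_lt.2 this hqr.1
  · rintro h x ⟨u, hu, hlt⟩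
    rw [edist_zero_left]
    exact not_lt.1 fun hx => h (x, u) hu ⟨hx, hlt⟩

theorem le_dMA_iff {r : ℝ≥0∞} {ω : N.Ω} :
    r ≤ N.dMA ω ↔ pointCount N.tbs (Metric.eball 0 r) ω = 0 := by
  rw [pointCount_eq_zero_iff, dMA, Metric.le_infEDist]
  simp only [Metric.mem_eball, not_lt, edist_comm]

/-- Independence from the TBSs is given at the level of `pointSigma`, so measurability with respect
to the ambient σ-algebra would not suffice. -/
theorem measurable_dUAL_pointSigma : Measurable[pointSigma N.uav] N.dUAL := by
  refine measurable_of_measurableSet_le (m := pointSigma N.uav) fun r => ?_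
  have : {ω | r ≤ N.dUAL ω} = {ω | pointCount N.uav (losRegion p r) ω = 0} :=
    Set.ext fun ω => N.le_dUAL_iff
  rw [this]
  exact measurableSet_pointSigma _ (measurableSet_losRegion p r)

theorem measurable_dUAN_pointSigma : Measurable[pointSigma N.uav] N.dUAN := by
  refine measurable_of_measurableSet_le (m := pointSigma N.uav) fun r => ?_
  have : {ω | r ≤ N.dUAN ω} = {ω | pointCount N.uav (nlosRegion p r) ω = 0} :=
    Set.ext fun ω => N.le_dUAN_iff
  rw [this]
  exact measurableSet_pointSigma _ (measurableSet_nlosRegion p r)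

theorem measurable_dMA_pointSigma : Measurable[pointSigma N.tbs] N.dMA := by
  refine measurable_of_measurableSet_le (m := pointSigma N.tbs) fun r => ?_
  have : {ω | r ≤ N.dMA ω} = {ω | pointCount N.tbs (Metric.eball 0 r) ω = 0} :=
    Set.ext fun ω => N.le_dMA_iff
  rw [this]
  exact measurableSet_pointSigma _ Metric.isOpen_eball.measurableSet

theorem measurable_dUAL : Measurable N.dUAL :=
  N.measurable_dUAL_pointSigma.mono (pointSigma_le N.uav_poisson.measurable_count) le_rfl

theorem measurable_dUAN : Measurable N.dUAN :=
  N.measurable_dUAN_pointSigma.mono (pointSigma_le N.uav_poisson.measurable_count) le_rfl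

theorem measurable_dMA : Measurable N.dMA :=
  N.measurable_dMA_pointSigma.mono (pointSigma_le N.tbs_poisson.measurable_count) le_rfl

theorem uav_intensity_toReal (S : Set (Space × I)) :
    (((lam : ℝ≥0∞) • ((volume.restrict upperSpace).prod volume) : Measure (Space × I)) S).toReal =
      lam * (markedVolume S).toReal := by
  rw [Measure.smul_apply, smul_eq_mul, ENNReal.toReal_mul]; rfl

theorem uav_intensity_ne_top {S : Set (Space × I)} (hS : markedVolume S ≠ ∞) :
    ((lam : ℝ≥0∞) • ((volume.restrict upperSpace).prod volume) : Measure (Space × I)) S ≠ ∞ := by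
  rw [Measure.smul_apply, smul_eq_mul]
  exact ENNReal.mul_ne_top ENNReal.coe_ne_top hS

theorem map_dUAL_Ici {r : ℝ} (hr : 0 ≤ r) :
    N.Pr.map N.dUAL (Set.Ici (ENNReal.ofReal r)) = ENNReal.ofReal
      (Real.exp (-(lam * (markedVolume (losRegion p 1)).toReal * r ^ (3 : ℝ)))) := by
  have hset : N.dUAL ⁻¹' Set.Ici (ENNReal.ofReal r) =
      {ω | pointCount N.uav (losRegion p (ENNReal.ofReal r)) ω = 0} :=
    Set.ext fun ω => N.le_dUAL_iff
  have hv := markedVolume_losRegion p hr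
  have hfin : markedVolume (losRegion p (ENNReal.ofReal r)) ≠ ∞ := by
    rw [hv]
    exact ENNReal.mul_ne_top ENNReal.ofReal_ne_top (markedVolume_unitBall_ne_top fun q hq => hq.1)
  rw [Measure.map_apply N.measurable_dUAL measurableSet_Ici, hset,
    N.uav_poisson.measure_pointCount_eq_zero (measurableSet_losRegion _ _)
      (uav_intensity_ne_top hfin), uav_intensity_toReal, hv, ENNReal.toReal_mul,
    ENNReal.toReal_ofReal (by positivity)]
  norm_cast
  ring_nf

theorem map_dUAN_Ici {r : ℝ} (hr : 0 ≤ r) :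
    N.Pr.map N.dUAN (Set.Ici (ENNReal.ofReal r)) = ENNReal.ofReal
      (Real.exp (-(lam * (markedVolume (nlosRegion p 1)).toReal * r ^ (3 : ℝ)))) := by
  have hset : N.dUAN ⁻¹' Set.Ici (ENNReal.ofReal r) =
      {ω | pointCount N.uav (nlosRegion p (ENNReal.ofReal r)) ω = 0} :=
    Set.ext fun ω => N.le_dUAN_iff
  have hv := markedVolume_nlosRegion p hr
  have hfin : markedVolume (nlosRegion p (ENNReal.ofReal r)) ≠ ∞ := by
    rw [hv]
    exact ENNReal.mul_ne_top ENNReal.ofReal_ne_top (markedVolume_unitBall_ne_top fun q hq => hq.1)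
  rw [Measure.map_apply N.measurable_dUAN measurableSet_Ici, hset,
    N.uav_poisson.measure_pointCount_eq_zero (measurableSet_nlosRegion _ _)
      (uav_intensity_ne_top hfin), uav_intensity_toReal, hv, ENNReal.toReal_mul,
    ENNReal.toReal_ofReal (by positivity)]
  norm_cast
  ring_nf

theorem map_dMA_Ici (hM : 0 < p.lamM) {r : ℝ} (hr : 0 ≤ r) :
    N.Pr.map N.dMA (Set.Ici (ENNReal.ofReal r)) = ENNReal.ofReal
      (Real.exp (-(p.lamM * discVolume * r ^ (2 : ℝ)))) := by
  have hset : N.dMA ⁻¹' Set.Ici (ENNReal.ofReal r) =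
      {ω | pointCount N.tbs (Metric.ball 0 r) ω = 0} := by
    rw [← Metric.eball_ofReal]
    exact Set.ext fun ω => N.le_dMA_iff
  have hv : (ENNReal.ofReal p.lamM • volume : Measure Ground) (Metric.ball 0 r) =
      ENNReal.ofReal p.lamM * (ENNReal.ofReal (r ^ 2) * volume (Metric.ball (0 : Ground) 1)) := by
    rw [Measure.smul_apply, smul_eq_mul, Measure.addHaar_ball _ _ hr, finrank_euclideanSpace,
      Fintype.card_fin]
  have hfin : (ENNReal.ofReal p.lamM • volume : Measure Ground) (Metric.ball 0 r) ≠ ∞ := by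
    rw [hv]
    exact ENNReal.mul_ne_top ENNReal.ofReal_ne_top
      (ENNReal.mul_ne_top ENNReal.ofReal_ne_top measure_ball_lt_top.ne)
  rw [Measure.map_apply N.measurable_dMA measurableSet_Ici, hset,
    N.tbs_poisson.measure_pointCount_eq_zero measurableSet_ball hfin, hv, ENNReal.toReal_mul,
    ENNReal.toReal_mul, ENNReal.toReal_ofReal hM.le, ENNReal.toReal_ofReal (by positivity),
    discVolume]
  norm_cast
  ring_nf

/-- The tail events are void events of disjoint marked regions, to which complete independence of
the Poisson process applies. -/
theorem indepFun_dUAL_dUAN : IndepFun N.dUAL N.dUAN N.Pr := by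
  refine indepFun_of_indep_Ici N.measurable_dUAL N.measurable_dUAN fun r s => ?_
  have hL : N.dUAL ⁻¹' Set.Ici r = pointCount N.uav (losRegion p r) ⁻¹' {0} :=
    Set.ext fun ω => N.le_dUAL_iff
  have hN : N.dUAN ⁻¹' Set.Ici s = pointCount N.uav (nlosRegion p s) ⁻¹' {0} :=
    Set.ext fun ω => N.le_dUAN_iff
  rw [hL, hN]
  have hd := disjoint_losRegion_nlosRegion p r s
  have h := N.uav_poisson.indep_count 2 ![losRegion p r, nlosRegion p s]
    (by intro i; fin_cases i
        exacts [measurableSet_losRegion p r, measurableSet_nlosRegion p s])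
    (by intro i j hij; fin_cases i <;> fin_cases j
        exacts [absurd rfl hij, hd, hd.symm, absurd rfl hij])
  exact (h.indepFun (i := 0) (j := 1) (by simp)).measure_inter_preimage_eq_mul _ _
    (measurableSet_singleton 0) (measurableSet_singleton 0)

/-- The joint law of the three distances is a product. -/
theorem map_distances : N.Pr.map (fun ω => (N.dUAL ω, N.dUAN ω, N.dMA ω)) =
    (N.Pr.map N.dUAL).prod ((N.Pr.map N.dUAN).prod (N.Pr.map N.dMA)) := by
  have h1 := (indepFun_iff_map_prod_eq_prod_map_map N.measurable_dUAL.aemeasurable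
    N.measurable_dUAN.aemeasurable).1 N.indepFun_dUAL_dUAN
  have hind : IndepFun (fun ω => (N.dUAL ω, N.dUAN ω)) N.dMA N.Pr := by
    rw [IndepFun_iff_Indep]
    refine indep_of_indep_of_le N.indep.symm ?_ N.measurable_dMA_pointSigma.comap_le
    exact (N.measurable_dUAL_pointSigma.prodMk N.measurable_dUAN_pointSigma).comap_le
  have h2 := (indepFun_iff_map_prod_eq_prod_map_map
    (N.measurable_dUAL.prodMk N.measurable_dUAN).aemeasurable N.measurable_dMA.aemeasurable).1 hind
  have := Measure.isProbabilityMeasure_map (μ := N.Pr) N.measurable_dMA.aemeasurable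
  rw [← Measure.prodAssoc_prod, ← h1, ← h2, Measure.map_map (by fun_prop)
    ((N.measurable_dUAL.prodMk N.measurable_dUAN).prodMk N.measurable_dMA)]
  rfl

/-- The right-hand side depends on the density but not on the chosen network, so networks on
unrelated probability spaces can be compared. -/
theorem losAssocProb_eq (hη : 0 < p.η) (hμ : 0 < p.μ) (hαL : 0 < p.αL) (hα : p.αL < p.αN)
    (hPUA : 0 < p.PUA) (hPM : 0 < p.PM) (hM : 0 < p.lamM) (hlam : 0 < lam) :
    N.losAssocProb = ∫ t, losDominance p lam (losDist p lam t) ∂(expMeasure 1) := by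
  have := isProbabilityMeasure_expMeasure one_pos
  have hpL := Measure.isProbabilityMeasure_map (μ := N.Pr) N.measurable_dUAL.aemeasurable
  have hpN := Measure.isProbabilityMeasure_map (μ := N.Pr) N.measurable_dUAN.aemeasurable
  have hpM := Measure.isProbabilityMeasure_map (μ := N.Pr) N.measurable_dMA.aemeasurable
  have hαN : 0 < p.αN := hαL.trans hα
  have hlamR : (0 : ℝ) < lam := hlam
  have hcL := mul_pos hlamR (markedVolume_losRegion_one_pos hη hμ)
  have hmL : Measurable fun t => ENNReal.ofReal (losDist p lam t) := by
    unfold losDist; fun_prop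
  have hlaw : N.Pr.map N.dUAL = (expMeasure 1).map fun t => ENNReal.ofReal (losDist p lam t) :=
    eq_map_expMeasure_of_weibull_tail hcL three_pos fun r hr => N.map_dUAL_Ici hr
  let S : Set (ℝ≥0∞ × ℝ≥0∞ × ℝ≥0∞) := {d |
    ENNReal.ofReal p.PUA * d.2.1 ^ (-p.αN) < ENNReal.ofReal p.PUA * d.1 ^ (-p.αL) ∧
    ENNReal.ofReal p.PM * d.2.2 ^ (-p.αN) < ENNReal.ofReal p.PUA * d.1 ^ (-p.αL)}
  have hS : MeasurableSet S := by
    have h1 : Measurable fun d : ℝ≥0∞ × ℝ≥0∞ × ℝ≥0∞ => ENNReal.ofReal p.PUA * d.2.1 ^ (-p.αN) := by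
      fun_prop
    have h2 : Measurable fun d : ℝ≥0∞ × ℝ≥0∞ × ℝ≥0∞ => ENNReal.ofReal p.PM * d.2.2 ^ (-p.αN) := by
      fun_prop
    have h3 : Measurable fun d : ℝ≥0∞ × ℝ≥0∞ × ℝ≥0∞ => ENNReal.ofReal p.PUA * d.1 ^ (-p.αL) := by
      fun_prop
    exact (measurableSet_lt h1 h3).inter (measurableSet_lt h2 h3)
  have hsec : ∀ t : ℝ, 0 < t → ((N.Pr.map N.dUAN).prod (N.Pr.map N.dMA))
      (Prod.mk (ENNReal.ofReal (losDist p lam t)) ⁻¹' S) =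
      ENNReal.ofReal (losDominance p lam (losDist p lam t)) := by
    intro t ht
    have hy : 0 < losDist p lam t := Real.rpow_pos_of_pos (by positivity) _
    set y := losDist p lam t
    -- `s` is the NLoS distance giving the same power as LoS distance `y`; the corresponding TBS
    -- distance is `(PM / PUA) ^ (1 / αN) * s`.
    set s := y ^ (p.αL / p.αN)
    have hs : 0 < s := Real.rpow_pos_of_pos hy _
    have hC : 0 < (p.PM / p.PUA) ^ (1 / p.αN) := Real.rpow_pos_of_pos (by positivity) _
    have hsy : ENNReal.ofReal y ^ (-p.αL) = ENNReal.ofReal s ^ (-p.αN) := by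
      rw [ENNReal.ofReal_rpow_of_pos hy, ENNReal.ofReal_rpow_of_pos hs, ← Real.rpow_mul hy.le]
      congr 2; field_simp
    have hsM : ENNReal.ofReal p.PUA * ENNReal.ofReal s ^ (-p.αN) =
        ENNReal.ofReal p.PM * ENNReal.ofReal ((p.PM / p.PUA) ^ (1 / p.αN) * s) ^ (-p.αN) := by
      rw [ENNReal.ofReal_rpow_of_pos hs, ENNReal.ofReal_rpow_of_pos (by positivity),
        ← ENNReal.ofReal_mul hPUA.le, ← ENNReal.ofReal_mul hPM.le,
        Real.mul_rpow hC.le hs.le, ← Real.rpow_mul (x := p.PM / p.PUA) (by positivity)]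
      rw [show 1 / p.αN * -p.αN = -1 by field_simp, Real.rpow_neg_one]
      congr 1; field_simp
    have hpre : Prod.mk (ENNReal.ofReal y) ⁻¹' S = Set.Ioi (ENNReal.ofReal s) ×ˢ
        Set.Ioi (ENNReal.ofReal ((p.PM / p.PUA) ^ (1 / p.αN) * s)) := by
      ext ⟨n, m⟩
      refine and_congr ?_ ?_
      · change _ * n ^ (-p.αN) < _ * ENNReal.ofReal y ^ (-p.αL) ↔ ENNReal.ofReal s < n
        rw [hsy, ofReal_mul_rpow_neg_lt_iff hPUA hαN]
      · change _ * m ^ (-p.αN) < _ * ENNReal.ofReal y ^ (-p.αL) ↔ ENNReal.ofReal _ < m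
        rw [hsy, hsM, ofReal_mul_rpow_neg_lt_iff hPM hαN]
    rw [hpre, Measure.prod_prod,
      measure_Ioi_of_weibull_tail three_pos (fun r hr => N.map_dUAN_Ici hr) hs.le,
      measure_Ioi_of_weibull_tail two_pos (fun r hr => N.map_dMA_Ici hM hr) (by positivity),
      ← ENNReal.ofReal_mul (Real.exp_pos _).le]
    rfl
  have hmeas : Measurable fun t => losDominance p lam (losDist p lam t) := by
    unfold losDominance losDist; fun_prop
  have hmain : N.Pr {ω | N.rUAN ω < N.rUAL ω ∧ N.rMA ω < N.rUAL ω} =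
      ∫⁻ t, ENNReal.ofReal (losDominance p lam (losDist p lam t)) ∂(expMeasure 1) := by
    -- Condition on the LoS distance by Tonelli, then replace its law by the exponential
    -- parametrization.
    have h := Measure.map_apply (μ := N.Pr)
      (N.measurable_dUAL.prodMk (N.measurable_dUAN.prodMk N.measurable_dMA)) hS
    rw [N.map_distances, Measure.prod_apply hS, hlaw,
      lintegral_map (measurable_measure_prodMk_left hS) hmL] at h
    refine h.symm.trans (lintegral_congr_ae ?_)
    filter_upwards [expMeasure_one_ae_pos] with t ht using hsec t ht
  have hnn : ∀ t, 0 ≤ losDominance p lam (losDist p lam t) := fun t => by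
    unfold losDominance; positivity
  rw [losAssocProb, measureReal_def, hmain,
    integral_eq_lintegral_of_nonneg_ae (Eventually.of_forall hnn) hmeas.aestronglyMeasurable]

theorem losAssocProb_nonneg : 0 ≤ N.losAssocProb := measureReal_nonneg

/-- Density zero is separate because `losDist` divides by it. The process is almost surely empty,
and received power 0 cannot win a strict comparison. -/
theorem losAssocProb_eq_zero (hαL : 0 < p.αL) (hlam : lam = 0) : N.losAssocProb = 0 := by
  have hL := N.uav_poisson.measure_pointCount_eq_zero MeasurableSet.univ (by simp [hlam])
  have hae : ∀ᵐ ω ∂N.Pr, pointCount N.uav Set.univ ω = 0 :=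
    (mem_ae_iff_prob_eq_one (N.uav_poisson.measurable_count _ MeasurableSet.univ
      (measurableSet_singleton 0))).2 (hL.trans (by simp [hlam]))
  have : N.Pr {ω | N.rUAN ω < N.rUAL ω ∧ N.rMA ω < N.rUAL ω} = 0 := by
    rw [measure_eq_zero_iff_ae_notMem]
    filter_upwards [hae] with ω hω hmem
    rw [pointCount_eq_zero_iff] at hω
    have hd : N.dUAL ω = ∞ := by
      rw [eq_top_iff, N.le_dUAL_iff, pointCount_eq_zero_iff]
      exact fun x hx => absurd trivial (hω x hx)
    have hr : N.rUAL ω = 0 := by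
      rw [rUAL, hd, ENNReal.top_rpow_of_neg (by linarith), mul_zero]
    exact not_lt_zero (hr ▸ hmem.1)
  rw [losAssocProb, measureReal_def, this, ENNReal.toReal_zero]

end UAVNetwork

/-! ### Continuity and limits of the network probability in the density. -/

theorem losDominance_nonneg (p : NetParams) (lam y : ℝ) : 0 ≤ losDominance p lam y :=
  mul_nonneg (Real.exp_pos _).le (Real.exp_pos _).le

theorem losDist_pos {p : NetParams} (hη : 0 < p.η) (hμ : 0 < p.μ) {lam t : ℝ} (hlam : 0 < lam)
    (ht : 0 < t) : 0 < losDist p lam t :=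
  Real.rpow_pos_of_pos (div_pos ht (mul_pos hlam (markedVolume_losRegion_one_pos hη hμ))) _

theorem losDominance_le_nlos {p : NetParams} (hM : 0 < p.lamM) (hPUA : 0 < p.PUA) (hPM : 0 < p.PM)
    (lam : ℝ) {y : ℝ} (hy : 0 ≤ y) : losDominance p lam y ≤
      Real.exp (-(lam * (markedVolume (nlosRegion p 1)).toReal *
        (y ^ (p.αL / p.αN)) ^ (3 : ℝ))) := by
  refine mul_le_of_le_one_right (Real.exp_pos _).le ?_
  rw [Real.exp_le_one_iff, neg_nonpos]
  have := discVolume_pos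
  positivity

theorem losDominance_le_tbs (p : NetParams) {lam y : ℝ} (hlam : 0 ≤ lam) (hy : 0 ≤ y) :
    losDominance p lam y ≤ Real.exp (-(p.lamM * discVolume *
      ((p.PM / p.PUA) ^ (1 / p.αN) * y ^ (p.αL / p.αN)) ^ (2 : ℝ))) := by
  refine mul_le_of_le_one_left (Real.exp_pos _).le ?_
  rw [Real.exp_le_one_iff, neg_nonpos]
  positivity

theorem norm_losDominance_le_one {p : NetParams} (hM : 0 < p.lamM) (hPUA : 0 < p.PUA)
    (hPM : 0 < p.PM) {lam y : ℝ} (hlam : 0 ≤ lam) (hy : 0 ≤ y) : ‖losDominance p lam y‖ ≤ 1 := by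
  rw [Real.norm_of_nonneg (losDominance_nonneg _ _ _)]
  refine (losDominance_le_nlos hM hPUA hPM lam hy).trans ?_
  rw [Real.exp_le_one_iff, neg_nonpos]
  positivity

theorem measurable_losDominance_losDist (p : NetParams) (lam : ℝ) :
    Measurable fun t => losDominance p lam (losDist p lam t) := by
  unfold losDominance losDist; fun_prop

theorem continuousOn_integral_losDominance {p : NetParams} (hη : 0 < p.η) (hμ : 0 < p.μ)
    (hαL : 0 < p.αL) (hα : p.αL < p.αN) (hPUA : 0 < p.PUA) (hPM : 0 < p.PM) (hM : 0 < p.lamM) :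
    ContinuousOn (fun lam => ∫ t, losDominance p lam (losDist p lam t) ∂(expMeasure 1))
      (Set.Ioi 0) := by
  have := isProbabilityMeasure_expMeasure one_pos
  intro lam₀ hlam₀
  refine ContinuousAt.continuousWithinAt (continuousAt_of_dominated (bound := fun _ => 1)
    (Eventually.of_forall fun lam => (measurable_losDominance_losDist p lam).aestronglyMeasurable)
    ?_ (integrable_const 1) ?_)
  · filter_upwards [Ioi_mem_nhds hlam₀] with lam hlam
    filter_upwards [expMeasure_one_ae_pos] with t ht
    exact norm_losDominance_le_one hM hPUA hPM (le_of_lt hlam) (losDist_pos hη hμ hlam ht).le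
  · filter_upwards [expMeasure_one_ae_pos] with t ht
    have hαN := hαL.trans hα
    have hcL := markedVolume_losRegion_one_pos hη hμ
    have h0 : ContinuousAt (fun lam => t / (lam * (markedVolume (losRegion p 1)).toReal)) lam₀ :=
      continuousAt_const.div (continuousAt_id.mul continuousAt_const) (mul_pos hlam₀ hcL).ne'
    have h1 : ContinuousAt (fun lam => losDist p lam t) lam₀ :=
      h0.rpow_const (Or.inr (by norm_num))
    have h2 : ContinuousAt (fun lam => losDist p lam t ^ (p.αL / p.αN)) lam₀ :=
      h1.rpow_const (Or.inr (by positivity))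
    have h3 : ContinuousAt (fun lam => (losDist p lam t ^ (p.αL / p.αN)) ^ (3 : ℝ)) lam₀ :=
      h2.rpow_const (Or.inr (by norm_num))
    have h4 : ContinuousAt (fun lam => ((p.PM / p.PUA) ^ (1 / p.αN) *
        losDist p lam t ^ (p.αL / p.αN)) ^ (2 : ℝ)) lam₀ :=
      (continuousAt_const.mul h2).rpow_const (Or.inr (by norm_num))
    unfold losDominance
    fun_prop

/-- Dominated convergence with bound 1, shared by both ends of the density range. -/
theorem tendsto_integral_losDominance {p : NetParams} (hη : 0 < p.η) (hμ : 0 < p.μ)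
    (hPUA : 0 < p.PUA) (hPM : 0 < p.PM) (hM : 0 < p.lamM)
    {l : Filter ℝ} [l.IsCountablyGenerated] (hl : ∀ᶠ lam in l, 0 < lam)
    (h : ∀ t, 0 < t → Tendsto (fun lam => losDominance p lam (losDist p lam t)) l (𝓝 0)) :
    Tendsto (fun lam => ∫ t, losDominance p lam (losDist p lam t) ∂(expMeasure 1)) l (𝓝 0) := by
  have := isProbabilityMeasure_expMeasure one_pos
  rw [← integral_zero ℝ ℝ (μ := expMeasure 1)]
  refine tendsto_integral_filter_of_dominated_convergence (fun _ => 1)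
    (Eventually.of_forall fun lam => (measurable_losDominance_losDist p lam).aestronglyMeasurable)
    ?_ (integrable_const 1) ?_
  · filter_upwards [hl] with lam hlam
    filter_upwards [expMeasure_one_ae_pos] with t ht
    exact norm_losDominance_le_one hM hPUA hPM hlam.le (losDist_pos hη hμ hlam ht).le
  · filter_upwards [expMeasure_one_ae_pos] with t ht using h t ht

theorem tendsto_integral_losDominance_atTop {p : NetParams} (hη : 0 < p.η) (hμ : 0 < p.μ)
    (hαL : 0 < p.αL) (hα : p.αL < p.αN) (hPUA : 0 < p.PUA) (hPM : 0 < p.PM) (hM : 0 < p.lamM) :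
    Tendsto (fun lam => ∫ t, losDominance p lam (losDist p lam t) ∂(expMeasure 1)) atTop
      (𝓝 0) := by
  refine tendsto_integral_losDominance hη hμ hPUA hPM hM (eventually_gt_atTop 0) fun t ht => ?_
  have hαN := hαL.trans hα
  have hβ : p.αL / p.αN < 1 := (div_lt_one hαN).2 hα
  have hcL := markedVolume_losRegion_one_pos hη hμ
  have hcN := markedVolume_nlosRegion_one_pos hη hμ
  set cL := (markedVolume (losRegion p 1)).toReal with hcLdef
  set cN := (markedVolume (nlosRegion p 1)).toReal with hcNdef
  -- The cube cancels the cube root in `losDist`, leaving `lam * (t / (lam * cL)) ^ (αL / αN)`; its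
  -- power of `lam` is positive since `αL < αN`.
  have hlim : Tendsto (fun lam : ℝ => Real.exp (-(cN * (t / cL) ^ (p.αL / p.αN) *
      lam ^ (1 - p.αL / p.αN)))) atTop (𝓝 0) :=
    Real.tendsto_exp_neg_atTop_nhds_zero.comp
      ((tendsto_rpow_atTop (by linarith)).const_mul_atTop (by positivity))
  refine squeeze_zero' (Eventually.of_forall fun _ => losDominance_nonneg _ _ _) ?_ hlim
  filter_upwards [eventually_gt_atTop 0] with lam hlam
  refine (losDominance_le_nlos hM hPUA hPM lam (losDist_pos hη hμ hlam ht).le).trans (le_of_eq ?_)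
  congr 2
  have hq : 0 ≤ t / (lam * cL) := by positivity
  rw [losDist, ← hcLdef, ← hcNdef, ← Real.rpow_mul hq, ← Real.rpow_mul hq,
    show 1 / 3 * (p.αL / p.αN) * 3 = p.αL / p.αN by ring, mul_comm lam cL, ← div_div,
    Real.div_rpow (by positivity) hlam.le, Real.rpow_sub hlam, Real.rpow_one]
  ring

theorem tendsto_integral_losDominance_zero {p : NetParams} (hη : 0 < p.η) (hμ : 0 < p.μ)
    (hαL : 0 < p.αL) (hα : p.αL < p.αN) (hPUA : 0 < p.PUA) (hPM : 0 < p.PM) (hM : 0 < p.lamM) :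
    Tendsto (fun lam => ∫ t, losDominance p lam (losDist p lam t) ∂(expMeasure 1)) (𝓝[>] 0)
      (𝓝 0) := by
  refine tendsto_integral_losDominance hη hμ hPUA hPM hM self_mem_nhdsWithin fun t ht => ?_
  have hαN := hαL.trans hα
  have hcL := markedVolume_losRegion_one_pos hη hμ
  have hd := discVolume_pos
  have hy : Tendsto (fun lam => losDist p lam t) (𝓝[>] 0) atTop := by
    refine (tendsto_rpow_atTop (by norm_num)).comp ?_
    refine (tendsto_inv_nhdsGT_zero.const_mul_atTop (div_pos ht hcL)).congr fun lam => ?_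
    rw [mul_comm lam, ← div_div, div_eq_mul_inv _ lam]
  have hlim : Tendsto (fun lam : ℝ => Real.exp (-(p.lamM * discVolume *
      ((p.PM / p.PUA) ^ (1 / p.αN) * losDist p lam t ^ (p.αL / p.αN)) ^ (2 : ℝ))))
      (𝓝[>] 0) (𝓝 0) :=
    Real.tendsto_exp_neg_atTop_nhds_zero.comp (((tendsto_rpow_atTop two_pos).comp
      (((tendsto_rpow_atTop (div_pos hαL hαN)).comp hy).const_mul_atTop
        (by positivity))).const_mul_atTop (by positivity))
  refine squeeze_zero' (Eventually.of_forall fun _ => losDominance_nonneg _ _ _) ?_ hlim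
  filter_upwards [self_mem_nhdsWithin] with lam hlam
  exact losDominance_le_tbs p (le_of_lt hlam) (losDist_pos hη hμ hlam ht).le

/-- The association probability of the network vanishes as the density grows and is maximal at a
positive density. -/
theorem losAssocProb_tendsto_and_exists_max {p : NetParams} (hη : 0 < p.η) (hμ : 0 < p.μ)
    (hαL : 0 < p.αL) (hα : p.αL < p.αN) (hPUA : 0 < p.PUA) (hPM : 0 < p.PM) (hM : 0 < p.lamM)
    (N : (lam : ℝ≥0) → UAVNetwork.{u} p lam) :
    Tendsto (fun lam => (N lam).losAssocProb) atTop (𝓝 0) ∧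
      ∃ lamOpt : ℝ≥0, 0 < lamOpt ∧
        ∀ lam : ℝ≥0, (N lam).losAssocProb ≤ (N lamOpt).losAssocProb := by
  have heq := fun (lam : ℝ≥0) (h : 0 < lam) => (N lam).losAssocProb_eq hη hμ hαL hα hPUA hPM hM h
  constructor
  · refine ((tendsto_integral_losDominance_atTop hη hμ hαL hα hPUA hPM hM).comp
      (NNReal.tendsto_coe_atTop.2 tendsto_id)).congr' ?_
    filter_upwards [eventually_gt_atTop 0] with lam h using (heq lam h).symm
  · obtain ⟨m, hm, hmax⟩ := exists_isMaxOn_Ioi_of_tendsto_zero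
      (continuousOn_integral_losDominance hη hμ hαL hα hPUA hPM hM)
      (fun lam _ => integral_nonneg fun t => losDominance_nonneg _ _ _)
      (tendsto_integral_losDominance_zero hη hμ hαL hα hPUA hPM hM)
      (tendsto_integral_losDominance_atTop hη hμ hαL hα hPUA hPM hM)
    refine ⟨⟨m, hm.le⟩, hm, fun lam => ?_⟩
    rcases eq_or_lt_of_le (zero_le : 0 ≤ lam) with h | h
    · rw [(N lam).losAssocProb_eq_zero hαL h.symm]
      exact (N _).losAssocProb_nonneg
    · rw [heq lam h, heq _ (show (0 : ℝ≥0) < ⟨m, hm.le⟩ from hm)]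
      exact hmax lam h

/-! ### The closed form: densities, brackets and inner integrals. -/

theorem continuous_WL {p : NetParams} (hη : 0 < p.η) : Continuous (WL p) := by
  unfold WL losProb
  refine continuous_const.div ?_ fun θ => by positivity
  have : Continuous fun θ => Real.arcsin (Real.cos θ / 1) :=
    Real.continuous_arcsin.comp (by fun_prop)
  fun_prop

theorem WL'_nonneg {p : NetParams} (hη : 0 < p.η) : 0 ≤ WL' p := by
  refine intervalIntegral.integral_nonneg (by positivity) fun θ hθ => mul_nonneg ?_
    (Real.sin_nonneg_of_nonneg_of_le_pi hθ.1 (by linarith [hθ.2, Real.pi_pos]))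
  unfold WL losProb; positivity

theorem WN'_pos {p : NetParams} (hη : 0 < p.η) (hμ : 0 < p.μ) : 0 < WN' p := by
  obtain ⟨_, b, -, -, -, hb1, h⟩ := exists_losProb_bounds hη hμ
  refine intervalIntegral.intervalIntegral_pos_of_pos_on ?_ ?_ (by positivity)
  · have := continuous_WL hη
    exact Continuous.intervalIntegrable (by fun_prop) _ _
  · intro θ hθ
    have h1 : WL p θ < 1 := (h _ _).2.trans hb1
    exact mul_pos (by linarith) (Real.sin_pos_of_pos_of_lt_pi hθ.1 (by linarith [hθ.2, Real.pi_pos]))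

theorem fMA_nonneg {p : NetParams} (hM : 0 < p.lamM) {x : ℝ} (hx : 0 ≤ x) : 0 ≤ fMA p x := by
  unfold fMA; positivity

theorem fUAL_nonneg {p : NetParams} (hη : 0 < p.η) {lam : ℝ} (hlam : 0 ≤ lam) (x : ℝ) :
    0 ≤ fUAL p lam x := by
  have := WL'_nonneg hη
  unfold fUAL; positivity

theorem fUAN_nonneg {p : NetParams} (hη : 0 < p.η) (hμ : 0 < p.μ) {lam : ℝ} (hlam : 0 ≤ lam)
    (x : ℝ) : 0 ≤ fUAN p lam x := by
  have := WN'_pos hη hμ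
  unfold fUAN; positivity

theorem integrableOn_fMA {p : NetParams} (hM : 0 < p.lamM) : IntegrableOn (fMA p) (Set.Ioi 0) := by
  have h := (integrableOn_rpow_mul_exp_neg_mul_rpow (s := 1) (p := 2) (b := Real.pi * p.lamM)
    (by norm_num) two_pos (by positivity)).const_mul (2 * Real.pi * p.lamM)
  refine h.congr (Eventually.of_forall fun x => ?_)
  simp only [fMA, Real.rpow_one, Real.rpow_two, neg_mul]
  ring

theorem integrableOn_sq_mul_exp_neg_cube {b : ℝ} (hb : 0 < b) :
    IntegrableOn (fun x : ℝ => x ^ 2 * Real.exp (-(b * x ^ 3))) (Set.Ioi 0) := by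
  refine (integrableOn_rpow_mul_exp_neg_mul_rpow (s := 2) (p := 3) (b := b)
    (by norm_num) three_pos hb).congr (Eventually.of_forall fun x => ?_)
  have h3 : x ^ (3 : ℝ) = x ^ 3 := by exact_mod_cast Real.rpow_natCast x 3
  simp only [Real.rpow_two, neg_mul, h3]

theorem integrableOn_fUAN {p : NetParams} (hη : 0 < p.η) (hμ : 0 < p.μ) {lam : ℝ} (hlam : 0 < lam) :
    IntegrableOn (fUAN p lam) (Set.Ioi 0) := by
  have hW := WN'_pos hη hμ
  refine ((integrableOn_sq_mul_exp_neg_cube (b := 2 / 3 * Real.pi * lam * WN' p)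
    (by positivity)).const_mul (2 * Real.pi * lam * WN' p)).congr (Eventually.of_forall fun x => ?_)
  simp only [fUAN]
  ring

/-- The total mass is free of the density, which keeps the constant in `AUAL_mem_Icc` uniform in
`lam`. -/
theorem integral_fUAN {p : NetParams} (hη : 0 < p.η) (hμ : 0 < p.μ) {lam : ℝ} (hlam : 0 < lam) :
    ∫ x in Set.Ioi 0, fUAN p lam x = 1 := by
  have hW := WN'_pos hη hμ
  have hb : 0 < 2 / 3 * Real.pi * lam * WN' p := by positivity
  have h := integral_rpow_mul_exp_neg_mul_rpow (q := 2) three_pos (by norm_num) hb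
  have hc : ∀ x : ℝ, fUAN p lam x = (2 * Real.pi * lam * WN' p) *
      (x ^ (2 : ℝ) * Real.exp (-(2 / 3 * Real.pi * lam * WN' p) * x ^ (3 : ℝ))) := by
    intro x
    have h3 : x ^ (3 : ℝ) = x ^ 3 := by exact_mod_cast Real.rpow_natCast x 3
    simp only [fUAN, Real.rpow_two, neg_mul, h3]
    ring
  simp_rw [hc]
  rw [integral_const_mul, h, show (-(2 + 1) / 3 : ℝ) = -1 by norm_num,
    show ((2 + 1) / 3 : ℝ) = 1 by norm_num, Real.Gamma_one, Real.rpow_neg_one]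
  field_simp

/-- The probability-like factor attached to the NLoS UAV-APs in the closed form. -/
def nlosFactor (p : NetParams) (lam d : ℝ) : ℝ :=
  Real.exp (-(2 / 3 * Real.pi * lam * WN' p * d ^ (3 * p.αL / p.αN)))

/-- The probability-like factor attached to the TBSs in the closed form. -/
def tbsFactor (p : NetParams) (d : ℝ) : ℝ :=
  Real.exp (-(Real.pi * p.lamM * ((p.PM / p.PUA) ^ (2 / p.αN) * d ^ (2 * p.αL / p.αN))))

theorem nlosFactor_pos (p : NetParams) (lam d : ℝ) : 0 < nlosFactor p lam d := Real.exp_pos _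

theorem tbsFactor_pos (p : NetParams) (d : ℝ) : 0 < tbsFactor p d := Real.exp_pos _

theorem nlosFactor_le_one {p : NetParams} (hη : 0 < p.η) (hμ : 0 < p.μ) {lam d : ℝ}
    (hlam : 0 ≤ lam) (hd : 0 ≤ d) : nlosFactor p lam d ≤ 1 := by
  have := WN'_pos hη hμ
  rw [nlosFactor, Real.exp_le_one_iff, neg_nonpos]
  positivity

theorem tbsFactor_le_one {p : NetParams} (hPUA : 0 < p.PUA) (hPM : 0 < p.PM) (hM : 0 < p.lamM)
    {d : ℝ} (hd : 0 ≤ d) : tbsFactor p d ≤ 1 := by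
  rw [tbsFactor, Real.exp_le_one_iff, neg_nonpos]
  positivity

/-- Beyond the threshold distance the bracket in `AUAL'` lies between `0` and its first term. -/
theorem nlosBracket_mem_Icc {p : NetParams} (hη : 0 < p.η) (hμ : 0 < p.μ) (hαN : 0 < p.αN)
    (hPUA : 0 < p.PUA) (hPM : 0 < p.PM) {lam d x : ℝ} (hlam : 0 ≤ lam) (hd : 0 ≤ d)
    (hx : (p.PM / p.PUA) ^ (1 / p.αN) * d ^ (p.αL / p.αN) < x) :
    nlosFactor p lam d - Real.exp (-(2 / 3 * Real.pi * lam * WN' p *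
      ((p.PUA / p.PM) ^ (3 / p.αN) * x ^ (3 * p.αN / p.αN)))) ∈ Set.Icc 0 (nlosFactor p lam d) := by
  have hW := WN'_pos hη hμ
  refine ⟨sub_nonneg.2 (Real.exp_le_exp.2 (neg_le_neg ?_)), sub_le_self _ (Real.exp_pos _).le⟩
  have hle : ((p.PM / p.PUA) ^ (1 / p.αN) * d ^ (p.αL / p.αN)) ^ (3 : ℝ) ≤ x ^ (3 : ℝ) :=
    Real.rpow_le_rpow (by positivity) hx.le (by norm_num)
  rw [Real.mul_rpow (by positivity) (by positivity), ← Real.rpow_mul (by positivity),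
    ← Real.rpow_mul hd] at hle
  rw [show p.αL / p.αN * 3 = 3 * p.αL / p.αN by ring,
    show 1 / p.αN * 3 = 3 / p.αN by ring] at hle
  rw [mul_div_cancel_right₀ _ hαN.ne']
  have hinv : (p.PUA / p.PM) ^ (3 / p.αN) * (p.PM / p.PUA) ^ (3 / p.αN) = 1 := by
    rw [← Real.mul_rpow (by positivity) (by positivity), div_mul_div_cancel₀ hPM.ne',
      div_self hPUA.ne', Real.one_rpow]
  have h2 := mul_le_mul_of_nonneg_left hle
    (by positivity : 0 ≤ (p.PUA / p.PM) ^ (3 / p.αN))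
  rw [← mul_assoc, hinv, one_mul] at h2
  gcongr

/-- Beyond the threshold distance the bracket in `AUAL''` lies between `0` and its first term. -/
theorem tbsBracket_mem_Icc {p : NetParams} (hαN : 0 < p.αN)
    (hPUA : 0 < p.PUA) (hPM : 0 < p.PM) (hM : 0 < p.lamM) {d x : ℝ} (hd : 0 ≤ d)
    (hx : d ^ (p.αL / p.αN) < x) :
    tbsFactor p d - Real.exp (-(Real.pi * p.lamM * ((p.PM / p.PUA) ^ (2 / p.αN) *
      x ^ (2 * p.αN / p.αN)))) ∈ Set.Icc 0 (tbsFactor p d) := by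
  refine ⟨sub_nonneg.2 (Real.exp_le_exp.2 (neg_le_neg ?_)), sub_le_self _ (Real.exp_pos _).le⟩
  have hle : (d ^ (p.αL / p.αN)) ^ (2 : ℝ) ≤ x ^ (2 : ℝ) :=
    Real.rpow_le_rpow (by positivity) hx.le (by norm_num)
  rw [← Real.rpow_mul hd, show p.αL / p.αN * 2 = 2 * p.αL / p.αN by ring] at hle
  rw [mul_div_cancel_right₀ _ hαN.ne']
  gcongr

/-- The integrand of `AUAL'`. -/
def integrandAUAL' (p : NetParams) (lam d x : ℝ) : ℝ :=
  (nlosFactor p lam d - Real.exp (-(2 / 3 * Real.pi * lam * WN' p *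
      ((p.PUA / p.PM) ^ (3 / p.αN) * x ^ (3 * p.αN / p.αN))))) * tbsFactor p d * fMA p x

/-- The integrand of `AUAL''`. -/
def integrandAUAL'' (p : NetParams) (lam d x : ℝ) : ℝ :=
  (tbsFactor p d - Real.exp (-(Real.pi * p.lamM * ((p.PM / p.PUA) ^ (2 / p.αN) *
      x ^ (2 * p.αN / p.αN))))) * nlosFactor p lam d * fUAN p lam x

theorem integrandAUAL'_mem_Icc {p : NetParams} (hη : 0 < p.η) (hμ : 0 < p.μ) (hαN : 0 < p.αN)
    (hPUA : 0 < p.PUA) (hPM : 0 < p.PM) (hM : 0 < p.lamM) {lam d x : ℝ} (hlam : 0 ≤ lam)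
    (hd : 0 ≤ d) (hx : (p.PM / p.PUA) ^ (1 / p.αN) * d ^ (p.αL / p.αN) < x) :
    integrandAUAL' p lam d x ∈ Set.Icc 0 (nlosFactor p lam d * tbsFactor p d * fMA p x) := by
  have h := nlosBracket_mem_Icc hη hμ hαN hPUA hPM hlam hd hx
  have hf : 0 ≤ fMA p x := fMA_nonneg hM (le_trans (by positivity) hx.le)
  have ht := (tbsFactor_pos p d).le
  exact ⟨mul_nonneg (mul_nonneg h.1 ht) hf,
    mul_le_mul_of_nonneg_right (mul_le_mul_of_nonneg_right h.2 ht) hf⟩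

theorem integrandAUAL''_mem_Icc {p : NetParams} (hη : 0 < p.η) (hμ : 0 < p.μ) (hαN : 0 < p.αN)
    (hPUA : 0 < p.PUA) (hPM : 0 < p.PM) (hM : 0 < p.lamM) {lam d x : ℝ} (hlam : 0 ≤ lam)
    (hd : 0 ≤ d) (hx : d ^ (p.αL / p.αN) < x) :
    integrandAUAL'' p lam d x ∈ Set.Icc 0 (tbsFactor p d * nlosFactor p lam d * fUAN p lam x) := by
  have h := tbsBracket_mem_Icc hαN hPUA hPM hM hd hx
  have hf : 0 ≤ fUAN p lam x := fUAN_nonneg hη hμ hlam x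
  have ht := (nlosFactor_pos p lam d).le
  exact ⟨mul_nonneg (mul_nonneg h.1 ht) hf,
    mul_le_mul_of_nonneg_right (mul_le_mul_of_nonneg_right h.2 ht) hf⟩

theorem measurable_integrandAUAL' (p : NetParams) (lam : ℝ) :
    Measurable fun q : ℝ × ℝ => integrandAUAL' p lam q.1 q.2 := by
  unfold integrandAUAL' nlosFactor tbsFactor fMA; fun_prop

theorem measurable_integrandAUAL'' (p : NetParams) (lam : ℝ) :
    Measurable fun q : ℝ × ℝ => integrandAUAL'' p lam q.1 q.2 := by
  unfold integrandAUAL'' nlosFactor tbsFactor fUAN; fun_prop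

/-- The moving domain is absorbed into the integrand as an indicator, leaving a parametric integral
over a fixed space. -/
theorem measurable_setIntegral_Ioi {a : ℝ → ℝ} {g : ℝ → ℝ → ℝ} (ha : Measurable a)
    (hg : Measurable fun q : ℝ × ℝ => g q.1 q.2) :
    Measurable fun d => ∫ x in Set.Ioi (a d), g d x := by
  have hm : Measurable fun q : ℝ × ℝ => if a q.1 < q.2 then g q.1 q.2 else 0 :=
    Measurable.ite (measurableSet_lt (by fun_prop) (by fun_prop)) hg measurable_const
  have hi := (hm.stronglyMeasurable.integral_prod_right' (ν := volume)).measurable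
  have heq : (fun d => ∫ x in Set.Ioi (a d), g d x) =
      fun d => ∫ x, if a d < x then g d x else 0 := by
    funext d
    rw [← integral_indicator measurableSet_Ioi]
    rfl
  rw [heq]
  exact hi

theorem measurable_AUAL (p : NetParams) (lam : ℝ) : Measurable (AUAL p lam) :=
  (measurable_setIntegral_Ioi (by fun_prop) (measurable_integrandAUAL' p lam)).add
    (measurable_setIntegral_Ioi (by fun_prop) (measurable_integrandAUAL'' p lam))

/-- Each bracket is dominated by its first term, which is constant in `x`; what remains is the total
mass of a density, finite for the TBSs and 1 for the NLoS UAV-APs. -/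
theorem AUAL_mem_Icc {p : NetParams} (hη : 0 < p.η) (hμ : 0 < p.μ) (hαN : 0 < p.αN)
    (hPUA : 0 < p.PUA) (hPM : 0 < p.PM) (hM : 0 < p.lamM) {lam d : ℝ} (hlam : 0 < lam)
    (hd : 0 ≤ d) : AUAL p lam d ∈
      Set.Icc 0 (((∫ x in Set.Ioi 0, fMA p x) + 1) * (nlosFactor p lam d * tbsFactor p d)) := by
  have hn := (nlosFactor_pos p lam d).le
  have ht := (tbsFactor_pos p d).le
  have hsub : ∀ {f : ℝ → ℝ} {a c : ℝ}, 0 ≤ a → 0 ≤ c → (∀ x, 0 ≤ x → 0 ≤ f x) →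
      IntegrableOn f (Set.Ioi 0) → ∀ g : ℝ → ℝ, (∀ x, a < x → g x ∈ Set.Icc 0 (c * f x)) →
      (∫ x in Set.Ioi a, g x) ∈ Set.Icc 0 (c * ∫ x in Set.Ioi 0, f x) := by
    intro f a c ha hc hf hfi g hg
    have hae : ∀ᵐ x ∂volume.restrict (Set.Ioi a), g x ∈ Set.Icc 0 (c * f x) :=
      (ae_restrict_mem measurableSet_Ioi).mono fun x hx => hg x hx
    refine ⟨integral_nonneg_of_ae (hae.mono fun x hx => hx.1), ?_⟩
    have hia := hfi.mono_set (Set.Ioi_subset_Ioi ha)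
    refine (integral_mono_of_nonneg (hae.mono fun x hx => hx.1) (hia.const_mul c)
      (hae.mono fun x hx => hx.2)).trans ?_
    rw [integral_const_mul]
    refine mul_le_mul_of_nonneg_left (setIntegral_mono_set hfi
      ((ae_restrict_mem measurableSet_Ioi).mono fun x hx => hf x (le_of_lt hx))
      (Set.Ioi_subset_Ioi ha).eventuallyLE) hc
  have h1 := hsub (by positivity) (mul_nonneg hn ht) (fun x hx => fMA_nonneg hM hx)
    (integrableOn_fMA hM) (integrandAUAL' p lam d)
    (fun x hx => integrandAUAL'_mem_Icc hη hμ hαN hPUA hPM hM hlam.le hd hx)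
  have h2 := hsub (by positivity) (mul_nonneg ht hn) (fun x _ => fUAN_nonneg hη hμ hlam.le x)
    (integrableOn_fUAN hη hμ hlam) (integrandAUAL'' p lam d)
    (fun x hx => integrandAUAL''_mem_Icc hη hμ hαN hPUA hPM hM hlam.le hd hx)
  rw [integral_fUAN hη hμ hlam] at h2
  refine ⟨add_nonneg h1.1 h2.1, (add_le_add h1.2 h2.2).trans (le_of_eq (by ring))⟩

theorem continuousAt_AUAL {p : NetParams} (hη : 0 < p.η) (hμ : 0 < p.μ) (hαN : 0 < p.αN)
    (hPUA : 0 < p.PUA) (hPM : 0 < p.PM) (hM : 0 < p.lamM) {lam₀ d : ℝ} (hlam₀ : 0 < lam₀)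
    (hd : 0 ≤ d) : ContinuousAt (fun lam => AUAL p lam d) lam₀ := by
  have hW := WN'_pos hη hμ
  -- `fUAN` itself varies with `lam`: its prefactor is bounded using `2 * lam₀`, its exponential
  -- using `lam₀ / 2`.
  have hnbhd : ∀ᶠ lam in 𝓝 lam₀, lam₀ / 2 < lam ∧ lam < 2 * lam₀ :=
    Ioo_mem_nhds (by linarith) (by linarith)
  have ht1 := tbsFactor_le_one hPUA hPM hM hd
  have ht0 := (tbsFactor_pos p d).le
  refine ContinuousAt.add ?_ ?_
  · refine continuousAt_of_dominated (F := fun lam x => integrandAUAL' p lam d x) (bound := fMA p)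
      (Eventually.of_forall fun lam => ((measurable_integrandAUAL' p lam).comp
        measurable_prodMk_left).aestronglyMeasurable) ?_
      ((integrableOn_fMA hM).mono_set (Set.Ioi_subset_Ioi (by positivity)))
      (Eventually.of_forall fun x => by unfold integrandAUAL' nlosFactor; fun_prop)
    filter_upwards [hnbhd] with lam hlam
    have hlam0 : 0 ≤ lam := by linarith [hlam.1]
    filter_upwards [ae_restrict_mem measurableSet_Ioi] with x hx
    have h := integrandAUAL'_mem_Icc hη hμ hαN hPUA hPM hM hlam0 hd hx
    have hf : 0 ≤ fMA p x := fMA_nonneg hM (le_trans (by positivity) (le_of_lt hx))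
    rw [Real.norm_of_nonneg h.1]
    exact h.2.trans (mul_le_of_le_one_left hf
      (mul_le_one₀ (nlosFactor_le_one hη hμ hlam0 hd) ht0 ht1))
  · refine continuousAt_of_dominated (F := fun lam x => integrandAUAL'' p lam d x)
      (bound := fun x => 2 * Real.pi * (2 * lam₀) * WN' p *
        (x ^ 2 * Real.exp (-(2 / 3 * Real.pi * (lam₀ / 2) * WN' p * x ^ 3))))
      (Eventually.of_forall fun lam => ((measurable_integrandAUAL'' p lam).comp
        measurable_prodMk_left).aestronglyMeasurable) ?_
      (((integrableOn_sq_mul_exp_neg_cube (by positivity)).mono_set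
        (Set.Ioi_subset_Ioi (by positivity))).const_mul _)
      (Eventually.of_forall fun x => by unfold integrandAUAL'' nlosFactor fUAN; fun_prop)
    filter_upwards [hnbhd] with lam hlam
    have hlam0 : 0 ≤ lam := by linarith [hlam.1]
    filter_upwards [ae_restrict_mem measurableSet_Ioi] with x hx
    have h := integrandAUAL''_mem_Icc hη hμ hαN hPUA hPM hM hlam0 hd hx
    have hx0 : 0 ≤ x := le_trans (by positivity) (le_of_lt hx)
    rw [Real.norm_of_nonneg h.1]
    refine (h.2.trans (mul_le_of_le_one_left (fUAN_nonneg hη hμ hlam0 x)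
      (mul_le_one₀ ht1 (nlosFactor_pos p lam d).le (nlosFactor_le_one hη hμ hlam0 hd)))).trans ?_
    rw [fUAN, mul_right_comm _ (x ^ 2), mul_assoc _ (x ^ 2)]
    gcongr
    exacts [hlam.2.le, hlam.1.le]

/-! ### The closed form: outer integral, limits and continuity. -/

theorem integrableOn_sq_mul_tbsFactor {p : NetParams} (hαL : 0 < p.αL) (hαN : 0 < p.αN)
    (hPUA : 0 < p.PUA) (hPM : 0 < p.PM) (hM : 0 < p.lamM) :
    IntegrableOn (fun y => y ^ 2 * tbsFactor p y) (Set.Ioi 0) := by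
  refine (integrableOn_rpow_mul_exp_neg_mul_rpow (s := 2) (p := 2 * p.αL / p.αN)
    (b := Real.pi * p.lamM * (p.PM / p.PUA) ^ (2 / p.αN)) (by norm_num) (by positivity)
    (by positivity)).congr (Eventually.of_forall fun x => ?_)
  simp only [tbsFactor, Real.rpow_two, neg_mul, mul_assoc]

theorem fUAL_le {p : NetParams} (hη : 0 < p.η) {lam y : ℝ} (hlam : 0 ≤ lam) (hy : 0 ≤ y) :
    fUAL p lam y ≤ 2 * Real.pi * WL' p * lam * y ^ 2 := by
  have hW := WL'_nonneg hη
  rw [fUAL, show 2 * Real.pi * WL' p * lam * y ^ 2 = 2 * Real.pi * lam * y ^ 2 * WL' p by ring]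
  refine mul_le_of_le_one_right (by positivity) ?_
  rw [Real.exp_le_one_iff, neg_nonpos]
  positivity

theorem AbarUAL_zero (p : NetParams) : AbarUAL p 0 = 0 := by
  simp [AbarUAL, fUAL]

theorem integral_fMA_add_one_nonneg {p : NetParams} (hM : 0 < p.lamM) :
    0 ≤ (∫ x in Set.Ioi 0, fMA p x) + 1 :=
  add_nonneg (setIntegral_nonneg measurableSet_Ioi fun _ hx => fMA_nonneg hM (le_of_lt hx))
    zero_le_one

theorem AUAL_mul_fUAL_mem_Icc {p : NetParams} (hη : 0 < p.η) (hμ : 0 < p.μ) (hαN : 0 < p.αN)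
    (hPUA : 0 < p.PUA) (hPM : 0 < p.PM) (hM : 0 < p.lamM) {lam y : ℝ} (hlam : 0 < lam)
    (hy : 0 ≤ y) : AUAL p lam y * fUAL p lam y ∈
      Set.Icc 0 (((∫ x in Set.Ioi 0, fMA p x) + 1) * (2 * Real.pi * WL' p) * lam *
        (y ^ 2 * (nlosFactor p lam y * tbsFactor p y))) := by
  have hA := AUAL_mem_Icc hη hμ hαN hPUA hPM hM hlam hy
  have hf := fUAL_nonneg hη hlam.le y
  refine ⟨mul_nonneg hA.1 hf, (mul_le_mul hA.2 (fUAL_le hη hlam.le hy) hf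
    (hA.1.trans hA.2)).trans (le_of_eq (by ring))⟩

theorem AbarUAL_nonneg {p : NetParams} (hη : 0 < p.η) (hμ : 0 < p.μ) (hαN : 0 < p.αN)
    (hPUA : 0 < p.PUA) (hPM : 0 < p.PM) (hM : 0 < p.lamM) {lam : ℝ} (hlam : 0 < lam) :
    0 ≤ AbarUAL p lam :=
  setIntegral_nonneg measurableSet_Ioi fun _ hy =>
    (AUAL_mul_fUAL_mem_Icc hη hμ hαN hPUA hPM hM hlam (le_of_lt hy)).1

/-- The majorant `g` is left free: the TBS factor serves small densities, the NLoS factor large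
ones. -/
theorem AbarUAL_le {p : NetParams} (hη : 0 < p.η) (hμ : 0 < p.μ) (hαN : 0 < p.αN)
    (hPUA : 0 < p.PUA) (hPM : 0 < p.PM) (hM : 0 < p.lamM) {lam : ℝ} (hlam : 0 < lam)
    {g : ℝ → ℝ} (hg : ∀ y, 0 < y → nlosFactor p lam y * tbsFactor p y ≤ g y)
    (hgi : IntegrableOn (fun y => y ^ 2 * g y) (Set.Ioi 0)) :
    AbarUAL p lam ≤ ((∫ x in Set.Ioi 0, fMA p x) + 1) * (2 * Real.pi * WL' p) * lam *
      ∫ y in Set.Ioi 0, y ^ 2 * g y := by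
  have hW := WL'_nonneg hη
  have hK := integral_fMA_add_one_nonneg hM
  rw [← integral_const_mul]
  refine integral_mono_of_nonneg ?_ (hgi.const_mul _) ?_
  · filter_upwards [ae_restrict_mem measurableSet_Ioi] with y hy
    exact (AUAL_mul_fUAL_mem_Icc hη hμ hαN hPUA hPM hM hlam (le_of_lt hy)).1
  · filter_upwards [ae_restrict_mem measurableSet_Ioi] with y hy
    refine (AUAL_mul_fUAL_mem_Icc hη hμ hαN hPUA hPM hM hlam (le_of_lt hy)).2.trans ?_
    have := hg y hy
    gcongr

theorem tendsto_AbarUAL_zero {p : NetParams} (hη : 0 < p.η) (hμ : 0 < p.μ) (hαL : 0 < p.αL)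
    (hαN : 0 < p.αN) (hPUA : 0 < p.PUA) (hPM : 0 < p.PM) (hM : 0 < p.lamM) :
    Tendsto (AbarUAL p) (𝓝[>] 0) (𝓝 0) := by
  have hlim : Tendsto (fun lam : ℝ => ((∫ x in Set.Ioi 0, fMA p x) + 1) * (2 * Real.pi * WL' p) *
      lam * ∫ y in Set.Ioi 0, y ^ 2 * tbsFactor p y) (𝓝[>] 0) (𝓝 0) := by
    refine Tendsto.mono_left ?_ nhdsWithin_le_nhds
    refine Continuous.tendsto' (by fun_prop) _ _ (by simp)
  refine squeeze_zero' ?_ ?_ hlim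
  · filter_upwards [self_mem_nhdsWithin] with lam hlam
    exact AbarUAL_nonneg hη hμ hαN hPUA hPM hM hlam
  · filter_upwards [self_mem_nhdsWithin] with lam hlam
    refine AbarUAL_le hη hμ hαN hPUA hPM hM hlam (fun y hy => ?_)
      (integrableOn_sq_mul_tbsFactor hαL hαN hPUA hPM hM)
    exact mul_le_of_le_one_left (tbsFactor_pos p y).le
      (nlosFactor_le_one hη hμ (le_of_lt hlam) hy.le)

theorem tendsto_AbarUAL_atTop {p : NetParams} (hη : 0 < p.η) (hμ : 0 < p.μ) (hαL : 0 < p.αL)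
    (hα : p.αL < p.αN) (hPUA : 0 < p.PUA) (hPM : 0 < p.PM) (hM : 0 < p.lamM) :
    Tendsto (AbarUAL p) atTop (𝓝 0) := by
  have hαN := hαL.trans hα
  have hW := WN'_pos hη hμ
  have hex : 0 < p.αN / p.αL - 1 := sub_pos.2 ((one_lt_div hαL).2 hα)
  set q := 3 * p.αL / p.αN with hq
  have hq0 : 0 < q := by positivity
  set b := 2 / 3 * Real.pi * WN' p with hb
  have hb0 : 0 < b := by positivity
  set K := ((∫ x in Set.Ioi 0, fMA p x) + 1) * (2 * Real.pi * WL' p) with hK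
  have hform : ∀ lam y : ℝ, y ^ 2 * nlosFactor p lam y =
      y ^ (2 : ℝ) * Real.exp (-(b * lam) * y ^ q) := by
    intro lam y
    rw [nlosFactor, Real.rpow_two, hb, ← hq, neg_mul]
    congr 3
    ring
  have hlim : Tendsto (fun lam : ℝ => K * (b ^ (-(2 + 1) / q) * (1 / q) * Real.Gamma ((2 + 1) / q)) *
      lam ^ (-(p.αN / p.αL - 1))) atTop (𝓝 0) := by
    simpa using (tendsto_rpow_neg_atTop hex).const_mul
      (K * (b ^ (-(2 + 1) / q) * (1 / q) * Real.Gamma ((2 + 1) / q)))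
  refine squeeze_zero' ?_ ?_ hlim
  · filter_upwards [eventually_gt_atTop 0] with lam hlam
    exact AbarUAL_nonneg hη hμ hαN hPUA hPM hM hlam
  · filter_upwards [eventually_gt_atTop 0] with lam hlam
    refine (AbarUAL_le hη hμ hαN hPUA hPM hM hlam (g := nlosFactor p lam) (fun y hy =>
      mul_le_of_le_one_right (nlosFactor_pos p lam y).le (tbsFactor_le_one hPUA hPM hM hy.le))
      ?_).trans (le_of_eq ?_)
    · simp_rw [hform]
      exact integrableOn_rpow_mul_exp_neg_mul_rpow (by norm_num) hq0 (by positivity)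
    · simp_rw [hform]
      rw [integral_rpow_mul_exp_neg_mul_rpow hq0 (by norm_num) (by positivity),
        -- The explicit factor `lam` contributes 1 and the Gamma integral contributes `-3 / q = -αN
        -- / αL`.
        Real.mul_rpow hb0.le hlam.le, show -(p.αN / p.αL - 1) = 1 + -(2 + 1) / q by
          rw [hq]; field_simp; ring, Real.rpow_add hlam, Real.rpow_one]
      ring

theorem continuousOn_AbarUAL {p : NetParams} (hη : 0 < p.η) (hμ : 0 < p.μ) (hαL : 0 < p.αL)
    (hαN : 0 < p.αN) (hPUA : 0 < p.PUA) (hPM : 0 < p.PM) (hM : 0 < p.lamM) :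
    ContinuousOn (AbarUAL p) (Set.Ioi 0) := by
  intro lam₀ hlam₀
  have hpos : 0 < lam₀ := hlam₀
  have hW := WL'_nonneg hη
  have hK := integral_fMA_add_one_nonneg hM
  have hfmeas : ∀ lam, Measurable (fUAL p lam) := fun lam => by unfold fUAL; fun_prop
  refine (continuousAt_of_dominated (F := fun lam y => AUAL p lam y * fUAL p lam y)
    (bound := fun y => ((∫ x in Set.Ioi 0, fMA p x) + 1) * (2 * Real.pi * WL' p) * (2 * lam₀) *
      (y ^ 2 * tbsFactor p y))
    (Eventually.of_forall fun lam =>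
      ((measurable_AUAL p lam).mul (hfmeas lam)).aestronglyMeasurable) ?_
    ((integrableOn_sq_mul_tbsFactor hαL hαN hPUA hPM hM).const_mul _) ?_).continuousWithinAt
  · filter_upwards [Ioo_mem_nhds (show 0 < lam₀ from hpos) (show lam₀ < 2 * lam₀ by linarith)]
      with lam hlam
    filter_upwards [ae_restrict_mem measurableSet_Ioi] with y hy
    have h := AUAL_mul_fUAL_mem_Icc hη hμ hαN hPUA hPM hM hlam.1 (le_of_lt hy)
    have ht := (tbsFactor_pos p y).le
    rw [Real.norm_of_nonneg h.1]
    refine h.2.trans ?_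
    have h2 : nlosFactor p lam y * tbsFactor p y ≤ tbsFactor p y :=
      mul_le_of_le_one_left ht (nlosFactor_le_one hη hμ hlam.1.le (le_of_lt hy))
    have h3 : 0 ≤ y ^ 2 * (nlosFactor p lam y * tbsFactor p y) :=
      mul_nonneg (sq_nonneg y) (mul_nonneg (nlosFactor_pos p lam y).le ht)
    gcongr
    exact hlam.2.le
  · filter_upwards [ae_restrict_mem measurableSet_Ioi] with y hy
    exact (continuousAt_AUAL hη hμ hαN hPUA hPM hM hpos (le_of_lt hy)).mul
      (by unfold fUAL; fun_prop)

/-- The closed-form expression vanishes as the density grows and is maximal at a positive density. -/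
theorem AbarUAL_tendsto_and_exists_max {p : NetParams} (hη : 0 < p.η) (hμ : 0 < p.μ)
    (hαL : 0 < p.αL) (hα : p.αL < p.αN) (hPUA : 0 < p.PUA) (hPM : 0 < p.PM) (hM : 0 < p.lamM) :
    Tendsto (AbarUAL p) atTop (𝓝 0) ∧
      ∃ lamOpt : ℝ, 0 < lamOpt ∧ ∀ lam : ℝ, 0 ≤ lam → AbarUAL p lam ≤ AbarUAL p lamOpt := by
  have hαN := hαL.trans hα
  have hinf := tendsto_AbarUAL_atTop hη hμ hαL hα hPUA hPM hM
  have hnn := fun lam (h : 0 < lam) => AbarUAL_nonneg hη hμ hαN hPUA hPM hM h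
  obtain ⟨m, hm, hmax⟩ := exists_isMaxOn_Ioi_of_tendsto_zero
    (continuousOn_AbarUAL hη hμ hαL hαN hPUA hPM hM) hnn
    (tendsto_AbarUAL_zero hη hμ hαL hαN hPUA hPM hM) hinf
  refine ⟨hinf, m, hm, fun lam hlam => ?_⟩
  rcases hlam.eq_or_lt with rfl | h
  · rw [AbarUAL_zero]; exact hnn m hm
  · exact hmax lam h

end

theorem proposition1 (p : NetParams) (hη : 0 < p.η) (hμ : 0 < p.μ)
    (hαL : 0 < p.αL) (hα : p.αL < p.αN) (hPUA : 0 < p.PUA) (hPM : 0 < p.PM) (hM : 0 < p.lamM) :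
    -- the association probability of the network, as a function of the UAV-AP density
    (∀ N : (lam : ℝ≥0) → UAVNetwork.{u} p lam,
      Tendsto (fun lam => (N lam).losAssocProb) atTop (𝓝 0) ∧
      ∃ lamOpt : ℝ≥0, 0 < lamOpt ∧
        ∀ lam : ℝ≥0, (N lam).losAssocProb ≤ (N lamOpt).losAssocProb) ∧
    -- the closed-form expression, as a function of the UAV-AP density
    (Tendsto (AbarUAL p) atTop (𝓝 0) ∧
      ∃ lamOpt : ℝ, 0 < lamOpt ∧ ∀ lam : ℝ, 0 ≤ lam → AbarUAL p lam ≤ AbarUAL p lamOpt) :=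
  ⟨losAssocProb_tendsto_and_exists_max hη hμ hαL hα hPUA hPM hM,
    AbarUAL_tendsto_and_exists_max hη hμ hαL hα hPUA hPM hM⟩
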